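/- Let $M,N\ge 1$. A frame for $\mathbb R^N$ is a sequence $\Phi=\{\varphi_i\}_{i=1}^M\subset\mathbb R^N$ with constants $0<A\le B<\infty$ such that $A\|x\|^2\le\sum_i|\langle x,\varphi_i\rangle|^2\le B\|x\|^2$ for all $x$; it is tight if one can take $A=B$, and scalable if there are scalars $s_i\ge 0$ such that $\{s_i\varphi_i\}_{i=1}^M$ is a tight frame. Let $\|\cdot\|_F$ be the Frobenius norm of the $N\times M$ matrix with the given columns, let $d_\Phi=\inf\{\|\Phi-\Psi\|_F:\Psi=\{\psi_i\}_{i=1}^M \text{ a scalable frame for }\mathbb R^N\}$, and let $K=\min\{M,\tfrac{N(N+1)}2\}$. For a positive definite matrix $X$ put $E(X)=\{v\in\mathbb R^N:\langle Xv,v\rangle\le 1\}$. The minimal ellipsoid $E_\Phi$ of $\Phi$ is the ellipsoid (with arbitrary center) of least volume containing the convex hull of $\{\pm\varphi_i\}_{i=1}^M$, and $V_\Phi$ is the volume of $E_\Phi$ divided by that of the unit ball. Theorem. Let $\Phi=\{\varphi_i\}_{i=1}^M$ be a frame of unit vectors for $\mathbb R^N$ with $d_\Phi\le\frac12(1+\sqrt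 K)^{-1}$. Then $E_\Phi=E(X)$ for some positive definite $X$, and there are $\rho_i\ge 0$, at most $K$ of them nonzero, with $X^{-1}=\sum_{i=1}^M\rho_i\varphi_i\varphi_i^T$. For every such choice, the sequence $\widetilde\Phi=\{\tilde\varphi_i\}_{i=1}^M$ given by $\tilde\varphi_i=V_\Phi^{1/N}X^{1/2}\varphi_i$ if $\rho_i>0$ and $\tilde\varphi_i=\varphi_i$ if $\rho_i=0$ is a scalable frame, and $$\|\widetilde\Phi-\Phi\|_F\le\sqrt{KN}\left(1-\sqrt{N\,\frac{(1-d_\Phi)^4-4Kd_\Phi^2}{N(1-d_\Phi)^4-4Kd_\Phi^2}}\right)^{1/2}\le C\,K\sqrt N\,d_\Phi,$$ where $C>0$ is an absolute constant; here the numerator and the denominator of the fraction are positive, and the inner square root is at most $1$. -/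

import Mathlib

open scoped MatrixOrder

noncomputable section

namespace ScalableFrames

/-- A sequence of `M` vectors in `ℝ^N` is a frame if it has frame bounds `0 < A` and `B`. -/
def IsFrame {M N : ℕ} (Φ : Fin M → EuclideanSpace ℝ (Fin N)) : Prop :=
  ∃ A B : ℝ, 0 < A ∧ 0 < B ∧ ∀ x : EuclideanSpace ℝ (Fin N),
    A * ‖x‖ ^ 2 ≤ ∑ i, |inner ℝ x (Φ i)| ^ 2 ∧ ∑ i, |inner ℝ x (Φ i)| ^ 2 ≤ B * ‖x‖ ^ 2

/-- A tight frame: the two frame bounds can be taken equal (and positive). -/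
def IsTightFrame {M N : ℕ} (Φ : Fin M → EuclideanSpace ℝ (Fin N)) : Prop :=
  ∃ A : ℝ, 0 < A ∧ ∀ x : EuclideanSpace ℝ (Fin N),
    ∑ i, |inner ℝ x (Φ i)| ^ 2 = A * ‖x‖ ^ 2

/-- A frame of unit vectors. -/
def IsUnitNormFrame {M N : ℕ} (Φ : Fin M → EuclideanSpace ℝ (Fin N)) : Prop :=
  IsFrame Φ ∧ ∀ i, ‖Φ i‖ = 1

/-- A frame that becomes tight after multiplying its vectors by suitable nonnegative scalars. -/
def IsScalable {M N : ℕ} (Φ : Fin M → EuclideanSpace ℝ (Fin N)) : Prop :=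
  IsFrame Φ ∧ ∃ s : Fin M → ℝ, (∀ i, 0 ≤ s i) ∧ IsTightFrame (fun i => s i • Φ i)

/-- Frobenius norm of the `N × M` matrix whose columns are the given vectors. -/
def frobeniusNorm {M N : ℕ} (Φ : Fin M → EuclideanSpace ℝ (Fin N)) : ℝ :=
  Real.sqrt (∑ i, ‖Φ i‖ ^ 2)

/-- The distance `d_Φ` (in Frobenius norm) of `Φ` to the set of scalable frames. -/
def scalableDist {M N : ℕ} (Φ : Fin M → EuclideanSpace ℝ (Fin N)) : ℝ :=
  sInf {r : ℝ | ∃ Ψ : Fin M → EuclideanSpace ℝ (Fin N),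
    IsScalable Ψ ∧ r = frobeniusNorm (Φ - Ψ)}

/-- The set `E(X, c) = {v : ⟨X (v - c), v - c⟩ ≤ 1}`; an ellipsoid when `X` is positive definite. -/
def ellipsoid {N : ℕ} (X : Matrix (Fin N) (Fin N) ℝ) (c : EuclideanSpace ℝ (Fin N)) :
    Set (EuclideanSpace ℝ (Fin N)) :=
  {v | inner ℝ (Matrix.toEuclideanLin X (v - c)) (v - c) ≤ 1}

/-- `E` is an ellipsoid of minimal volume among all ellipsoids (with arbitrary centers)
containing `S`. -/
structure IsMinimalEllipsoid {N : ℕ} (S E : Set (EuclideanSpace ℝ (Fin N))) : Prop where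
  isEllipsoid : ∃ (X : Matrix (Fin N) (Fin N) ℝ) (c : EuclideanSpace ℝ (Fin N)),
    X.PosDef ∧ E = ellipsoid X c
  subset : S ⊆ E
  volume_le : ∀ (Y : Matrix (Fin N) (Fin N) ℝ) (c : EuclideanSpace ℝ (Fin N)),
    Y.PosDef → S ⊆ ellipsoid Y c →
      MeasureTheory.volume E ≤ MeasureTheory.volume (ellipsoid Y c)

/-- The symmetrized frame `{φ_i} ∪ {-φ_i}`. -/
def symmetrized {M N : ℕ} (Φ : Fin M → EuclideanSpace ℝ (Fin N)) :
    Set (EuclideanSpace ℝ (Fin N)) :=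
  Set.range Φ ∪ Set.range (fun i => -Φ i)

/-- `E` is the minimal ellipsoid of `Φ`, that is, of the convex hull of the symmetrized frame. -/
def IsMinimalEllipsoidOf {M N : ℕ} (Φ : Fin M → EuclideanSpace ℝ (Fin N))
    (E : Set (EuclideanSpace ℝ (Fin N))) : Prop :=
  IsMinimalEllipsoid (convexHull ℝ (symmetrized Φ)) E

/-- Volume divided by the volume `ω_N` of the unit ball. -/
def normalizedVolume {N : ℕ} (E : Set (EuclideanSpace ℝ (Fin N))) : ℝ :=
  (MeasureTheory.volume E).toReal /
    (MeasureTheory.volume (Metric.closedBall (0 : EuclideanSpace ℝ (Fin N)) 1)).toReal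

/-- The number `K = min {M, N (N + 1) / 2}`. -/
def numK (M N : ℕ) : ℕ := min M (N * (N + 1) / 2)

/-- Weights `ρ_i ≥ 0`, at most `K` of them nonzero, with `X⁻¹ = ∑ ρ_i φ_i φ_iᵀ`. -/
structure IsWeight {M N : ℕ} (Φ : Fin M → EuclideanSpace ℝ (Fin N))
    (X : Matrix (Fin N) (Fin N) ℝ) (ρ : Fin M → ℝ) : Prop where
  nonneg : ∀ i, 0 ≤ ρ i
  card_le : (Finset.univ.filter (fun i => 0 < ρ i)).card ≤ numK M N
  inv_eq : X⁻¹ = ∑ i, ρ i • Matrix.vecMulVec (Φ i).ofLp (Φ i).ofLp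

open Classical in
/-- The approximating frame: `φ̃_i = V^{1/N} X^{1/2} φ_i` if `ρ_i > 0`, and `φ̃_i = φ_i` otherwise,
where `V` is the normalized volume of `E(X)` and `X^{1/2}` is the positive square root. -/
def approxFrame {M N : ℕ} (Φ : Fin M → EuclideanSpace ℝ (Fin N))
    (X : Matrix (Fin N) (Fin N) ℝ) (ρ : Fin M → ℝ) : Fin M → EuclideanSpace ℝ (Fin N) :=
  fun i =>
    if 0 < ρ i then
      (normalizedVolume (ellipsoid X 0) ^ (1 / (N : ℝ))) •
        Matrix.toEuclideanLin (CFC.sqrt X) (Φ i)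
    else Φ i

/-- The numerator `(1 - d)^4 - 4 K d²`. -/
def boundNum (K : ℕ) (d : ℝ) : ℝ := (1 - d) ^ 4 - 4 * K * d ^ 2

/-- The denominator `N (1 - d)^4 - 4 K d²`. -/
def boundDen (K N : ℕ) (d : ℝ) : ℝ := N * (1 - d) ^ 4 - 4 * K * d ^ 2

/-- The error bound, as a function of `K`, `N` and `d`. -/
def errorBound (K N : ℕ) (d : ℝ) : ℝ :=
  Real.sqrt (K * N) * Real.sqrt (1 - Real.sqrt (N * (boundNum K d / boundDen K N d)))

end ScalableFrames

end

namespace ScalableFrames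

/-! An ellipsoid around a symmetric set may be recentred at the origin, so minimal volume means
maximal `X.det` subject to `⟨X φ_i, φ_i⟩ ≤ 1`. First-order optimality and separation put `N⁻¹ X⁻¹`
in the convex hull of the `φ_i φ_iᵀ` (`smul_inv_mem_convexHull`). Carathéodory then gives the
weights, and unit norms give `tr X⁻¹ = N` and tightness of the constraint wherever `ρ_i > 0`. The
identity `X^{1/2} X⁻¹ X^{1/2} = 1` makes the new frame scalable.

For the error put `P = X^{-1/2}` and `v = V^{1/N}`. A modified vector moves by `(v - P)ψ` with `ψ =
X^{1/2} φ` a unit vector, and AM-GM on `tr P` bounds the square by `N (1 - v²)`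
(`norm_sq_smul_sqrt_sub_le`).

It remains to bound `V² = det X⁻¹` below. A scalable frame near `Φ` yields `S = ∑ e_i φ_i φ_iᵀ` with
trace `N` and `‖S - 1‖_F² ≤ 2 N d²` (`exists_weights_near`). Hence `det S ≥ 1 - 2 N d²`, while `tr
(X S) ≤ N` forces `det X * det S ≤ 1`. The resulting bound `1 - 2 N d²` dominates the stated
fraction when `N ≥ 2`; for `N = 1`, `V = 1`. -/

/-! ### Products of numbers near 1 -/

theorem exp_sub_sq_le {y : ℝ} (hy : -1 / 2 ≤ y) : Real.exp (y - y ^ 2) ≤ 1 + y := by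
  have hpos : 0 < 1 + y := by linarith
  rw [← Real.le_log_iff_exp_le hpos]
  rcases le_total 0 y with h | h
  · refine le_trans ?_ (Real.le_log_one_add_of_nonneg h)
    rw [le_div_iff₀ (by linarith)]
    nlinarith [pow_nonneg h 2, pow_nonneg h 3]
  · obtain ⟨u, rfl⟩ : ∃ u, y = -u := ⟨-y, by ring⟩
    have h0 : 0 ≤ u := by linarith
    have h1 : u ≤ 1 / 2 := by linarith
    have hq := Real.quadratic_le_exp_of_nonneg (x := u + u ^ 2) (by positivity)
    have hlow : 1 ≤ Real.exp (u + u ^ 2) * (1 + -u) := by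
      refine le_trans ?_ (mul_le_mul_of_nonneg_right hq hpos.le)
      have h2 : 0 ≤ u ^ 2 * ((1 + u) ^ 2 * (1 - u) - 2 * u) := by
        refine mul_nonneg (by positivity) ?_
        nlinarith [mul_nonneg h0 (sub_nonneg.2 h1), mul_nonneg (mul_nonneg h0 h0) (sub_nonneg.2 h1)]
      nlinarith
    rw [Real.le_log_iff_exp_le hpos]
    have he : Real.exp (-u - (-u) ^ 2) * Real.exp (u + u ^ 2) = 1 := by
      rw [← Real.exp_add, ← Real.exp_zero]; congr 1; ring
    nlinarith [Real.exp_pos (u + u ^ 2), Real.exp_pos (-u - (-u) ^ 2)]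

theorem exp_sum_sub_sum_sq_le_prod {ι : Type*} (s : Finset ι) (y : ι → ℝ)
    (h : ∀ i ∈ s, -1 / 2 ≤ y i) :
    Real.exp (∑ i ∈ s, y i - ∑ i ∈ s, y i ^ 2) ≤ ∏ i ∈ s, (1 + y i) := by
  rw [← Finset.sum_sub_distrib, Real.exp_sum]
  exact Finset.prod_le_prod (fun _ _ => (Real.exp_pos _).le) fun i hi => exp_sub_sq_le (h i hi)

theorem one_sub_sum_sq_le_prod {ι : Type*} [Fintype ι] (y : ι → ℝ)
    (h0 : ∑ i, y i = 0) (h : ∑ i, y i ^ 2 ≤ 1 / 2) :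
    1 - ∑ i, y i ^ 2 ≤ ∏ i, (1 + y i) := by
  classical
  by_cases hall : ∀ i, -1 / 2 ≤ y i
  · have h1 := exp_sum_sub_sum_sq_le_prod Finset.univ y fun i _ => hall i
    have h2 := Real.add_one_le_exp (∑ i, y i - ∑ i, y i ^ 2)
    linarith
  -- If `y m < -1/2`, the other squares sum to `τ < 1/4`, so `m` is the only exception. The other
  -- factors have product at least `(1 - y m) * (1 - τ)`; multiplying by `1 + y m` gives `(1 - y m ^
  -- 2) * (1 - τ)`.
  · push Not at hall
    obtain ⟨m, hm⟩ := hall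
    rw [← Finset.add_sum_erase _ _ (Finset.mem_univ m)] at h0 h ⊢
    rw [← Finset.mul_prod_erase _ _ (Finset.mem_univ m)]
    set τ := ∑ i ∈ Finset.univ.erase m, y i ^ 2 with hτ
    have hτ0 : 0 ≤ τ := Finset.sum_nonneg fun i _ => sq_nonneg _
    have h1 := exp_sum_sub_sum_sq_le_prod (Finset.univ.erase m) y (fun i hi => by
      have : y i ^ 2 ≤ τ := Finset.single_le_sum (f := fun i => y i ^ 2)
        (fun i _ => sq_nonneg _) hi
      nlinarith)
    have hs : ∑ i ∈ Finset.univ.erase m, y i = -y m := by linarith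
    rw [← hτ, hs, sub_eq_add_neg, Real.exp_add] at h1
    have h2 : (1 - y m) * (1 - τ) ≤ Real.exp (-y m) * Real.exp (-τ) := by
      have a := Real.add_one_le_exp (-y m)
      have b := Real.add_one_le_exp (-τ)
      exact mul_le_mul (by linarith) (by linarith) (by nlinarith) (Real.exp_pos _).le
    have hm1 : 0 ≤ 1 + y m := by nlinarith
    have h3 := mul_le_mul_of_nonneg_left (h2.trans h1) hm1
    nlinarith [mul_nonneg hτ0 (sq_nonneg (y m))]

/-! ### Estimates for the explicit bound -/

section Numerics

variable {N K : ℕ} {d : ℝ}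

theorem two_mul_sqrt_mul_le (hd : d ≤ 1 / 2 * (1 + √(K : ℝ))⁻¹) :
    2 * (√(K : ℝ) * d) ≤ 1 - 2 * d := by
  have hs := Real.sqrt_nonneg (K : ℝ)
  have : d * (1 + √(K : ℝ)) ≤ 1 / 2 := by
    rwa [← div_eq_mul_inv, le_div_iff₀ (by positivity)] at hd
  linarith

theorem boundNum_pos (hd0 : 0 ≤ d) (hd : d ≤ 1 / 2 * (1 + √(K : ℝ))⁻¹) :
    0 < boundNum K d := by
  have h := two_mul_sqrt_mul_le hd
  have hK : √(K : ℝ) ^ 2 = K := Real.sq_sqrt (Nat.cast_nonneg K)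
  have h0 : 0 ≤ √(K : ℝ) * d := by positivity
  have h1 : 2 * (√(K : ℝ) * d) < (1 - d) ^ 2 := by
    rcases hd0.eq_or_lt with rfl | hpos
    · simp
    · nlinarith [pow_pos hpos 2]
  have h2 : (2 * (√(K : ℝ) * d)) ^ 2 < ((1 - d) ^ 2) ^ 2 := by gcongr
  have h3 : (2 * (√(K : ℝ) * d)) ^ 2 = 4 * K * d ^ 2 := by rw [mul_pow, mul_pow, hK]; ring
  unfold boundNum
  nlinarith

theorem boundDen_pos (hN : 1 ≤ N) (hd0 : 0 ≤ d) (hd : d ≤ 1 / 2 * (1 + √(K : ℝ))⁻¹) :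
    0 < boundDen K N d := by
  have h := boundNum_pos hd0 hd
  have hN' : (1 : ℝ) ≤ N := by exact_mod_cast hN
  unfold boundNum at h
  unfold boundDen
  nlinarith [pow_nonneg (sq_nonneg (1 - d)) 2]

theorem mul_boundNum_div_boundDen_le_one (hN : 1 ≤ N) (hd0 : 0 ≤ d)
    (hd : d ≤ 1 / 2 * (1 + √(K : ℝ))⁻¹) : N * (boundNum K d / boundDen K N d) ≤ 1 := by
  have hN' : (1 : ℝ) ≤ N := by exact_mod_cast hN
  rw [← mul_div_assoc, div_le_one (boundDen_pos hN hd0 hd)]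
  unfold boundNum boundDen
  have : 0 ≤ (K : ℝ) * d ^ 2 := by positivity
  nlinarith

theorem le_quarter (hK : 1 ≤ K) (hd : d ≤ 1 / 2 * (1 + √(K : ℝ))⁻¹) : d ≤ 1 / 4 := by
  have h1 : (1 : ℝ) ≤ √(K : ℝ) := Real.one_le_sqrt.2 (by exact_mod_cast hK)
  have : (1 + √(K : ℝ))⁻¹ ≤ 2⁻¹ := inv_anti₀ (by norm_num) (by linarith)
  linarith

/-- With `t = N (numerator) / (denominator)`, the defect `1 - t` is at most `16 K d²`. -/
theorem one_sub_mul_boundNum_div_boundDen_le (hN : 1 ≤ N) (hK : 1 ≤ K) (hd0 : 0 ≤ d)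
    (hd : d ≤ 1 / 2 * (1 + √(K : ℝ))⁻¹) :
    1 - N * (boundNum K d / boundDen K N d) ≤ 16 * (K * d ^ 2) := by
  have hN' : (1 : ℝ) ≤ N := by exact_mod_cast hN
  have hden := boundDen_pos hN hd0 hd
  have hnum := boundNum_pos hd0 hd
  have hq := le_quarter hK hd
  rw [← mul_div_assoc, sub_le_iff_le_add, ← sub_le_iff_le_add', le_div_iff₀ hden]
  have hk : 0 ≤ (K : ℝ) * d ^ 2 := by positivity
  have h4 : 1 / 4 ≤ (1 - d) ^ 4 := by
    have : (3 / 4 : ℝ) ^ 4 ≤ (1 - d) ^ 4 := by gcongr; linarith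
    linarith [show (1 : ℝ) / 4 ≤ (3 / 4 : ℝ) ^ 4 by norm_num]
  -- The denominator is the numerator plus `(N - 1) (1 - d)^4`.
  have h5 : (N - 1) / 4 ≤ boundDen K N d := by
    unfold boundNum at hnum
    unfold boundDen
    nlinarith
  have h6 : boundDen K N d - N * boundNum K d = 4 * (N - 1) * (K * d ^ 2) := by
    unfold boundNum boundDen; ring
  nlinarith [mul_le_mul_of_nonneg_left h5 hk]

theorem errorBound_le (hN : 1 ≤ N) (hK : 1 ≤ K) (hd0 : 0 ≤ d)
    (hd : d ≤ 1 / 2 * (1 + √(K : ℝ))⁻¹) :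
    errorBound K N d ≤ 4 * (K * √(N : ℝ) * d) := by
  have h1 := one_sub_mul_boundNum_div_boundDen_le hN hK hd0 hd
  have h2 := mul_boundNum_div_boundDen_le_one hN hd0 hd
  unfold errorBound
  set t := N * (boundNum K d / boundDen K N d) with ht
  have ht0 : 0 ≤ t := by
    have := boundNum_pos hd0 hd
    have := boundDen_pos hN hd0 hd
    positivity
  have h3 : t ≤ √t := by
    rw [Real.le_sqrt ht0 ht0]; nlinarith
  have h4 : √(1 - √t) ≤ 4 * (√(K : ℝ) * d) := by
    rw [Real.sqrt_le_left (by positivity)]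
    have hK : √(K : ℝ) ^ 2 = K := Real.sq_sqrt (Nat.cast_nonneg K)
    calc 1 - √t ≤ 1 - t := by linarith
      _ ≤ 16 * (K * d ^ 2) := h1
      _ = _ := by rw [mul_pow, mul_pow, hK]; ring
  calc √(K * N : ℝ) * √(1 - √t) ≤ √(K * N : ℝ) * (4 * (√(K : ℝ) * d)) := by gcongr
    _ = 4 * ((√(K : ℝ) * √(K : ℝ)) * √(N : ℝ) * d) := by
      rw [Real.sqrt_mul (Nat.cast_nonneg K)]; ring
    _ = _ := by rw [Real.mul_self_sqrt (Nat.cast_nonneg K)]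

/-- Links the determinant estimate to the stated fraction: the defect is `4 (N - 1) K d²` over a
denominator at most `N`, and `2 (N - 1) ≥ N`, `K ≥ N`. -/
theorem mul_boundNum_div_boundDen_le (hN : 2 ≤ N) (hNK : N ≤ K) (hd0 : 0 ≤ d)
    (hd : d ≤ 1 / 2 * (1 + √(K : ℝ))⁻¹) :
    N * (boundNum K d / boundDen K N d) ≤ 1 - 2 * (N * d ^ 2) := by
  have hN' : (2 : ℝ) ≤ N := by exact_mod_cast hN
  have hNK' : (N : ℝ) ≤ K := by exact_mod_cast hNK
  have hden := boundDen_pos (show 1 ≤ N by lia) hd0 hd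
  have hnum := boundNum_pos hd0 hd
  have hq := le_quarter (show 1 ≤ K by lia) hd
  rw [← mul_div_assoc, div_le_iff₀ hden]
  have h6 : boundDen K N d - N * boundNum K d = 4 * (N - 1) * (K * d ^ 2) := by
    unfold boundNum boundDen; ring
  have h7 : boundDen K N d ≤ N := by
    unfold boundDen
    have : (1 - d) ^ 4 ≤ 1 := pow_le_one₀ (by linarith) (by linarith)
    have : 0 ≤ (K : ℝ) * d ^ 2 := by positivity
    nlinarith
  have h8 : 2 * (N * d ^ 2) * boundDen K N d ≤ 2 * (N * d ^ 2) * N := by gcongr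
  have h9 : N * d ^ 2 ≤ K * d ^ 2 := by gcongr
  have h10 : 0 ≤ N * d ^ 2 := by positivity
  nlinarith

end Numerics

/-! ### Ellipsoids, volume and determinant -/

open Matrix Filter Topology

variable {M N : ℕ} {Φ Ψ : Fin M → EuclideanSpace ℝ (Fin N)} {X : Matrix (Fin N) (Fin N) ℝ}

theorem inner_toEuclideanLin (X : Matrix (Fin N) (Fin N) ℝ) (v w : EuclideanSpace ℝ (Fin N)) :
    inner ℝ (toEuclideanLin X v) w = w.ofLp ⬝ᵥ X *ᵥ v.ofLp := by
  simp [EuclideanSpace.inner_eq_star_dotProduct]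

theorem dotProduct_self_eq_norm_sq (v : EuclideanSpace ℝ (Fin N)) :
    v.ofLp ⬝ᵥ v.ofLp = ‖v‖ ^ 2 := by
  rw [← real_inner_self_eq_norm_sq, EuclideanSpace.inner_eq_star_dotProduct]
  simp

theorem trace_mul_vecMulVec_self (X : Matrix (Fin N) (Fin N) ℝ) (v : Fin N → ℝ) :
    (X * vecMulVec v v).trace = v ⬝ᵥ X *ᵥ v := by
  rw [mul_vecMulVec, trace_vecMulVec, dotProduct_comm]

theorem transpose_sqrt (X : Matrix (Fin N) (Fin N) ℝ) : (CFC.sqrt X)ᵀ = CFC.sqrt X := by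
  have := (CFC.sqrt_nonneg X).posSemidef.isHermitian
  rwa [IsHermitian, conjTranspose_eq_transpose_of_trivial] at this

theorem sqrt_mul_sqrt (hX : X.PosDef) : CFC.sqrt X * CFC.sqrt X = X :=
  CFC.sqrt_mul_sqrt_self X hX.posSemidef.nonneg

theorem norm_sq_toEuclideanLin_sqrt (hX : X.PosDef) (v : EuclideanSpace ℝ (Fin N)) :
    ‖toEuclideanLin (CFC.sqrt X) v‖ ^ 2 = v.ofLp ⬝ᵥ X *ᵥ v.ofLp := by
  rw [← dotProduct_self_eq_norm_sq]
  conv_rhs => rw [← sqrt_mul_sqrt hX, ← mulVec_mulVec, dotProduct_mulVec, ← mulVec_transpose,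
    transpose_sqrt]
  simp

theorem det_sqrt_eq (hX : X.PosDef) : (CFC.sqrt X).det = √X.det := by
  rw [hX.posSemidef.det_sqrt, RCLike.sqrt_of_nonneg hX.posSemidef.det_nonneg]
  simp

theorem ellipsoid_eq_preimage (hX : X.PosDef) (c : EuclideanSpace ℝ (Fin N)) :
    ellipsoid X c = (· + -c) ⁻¹' (toEuclideanLin (CFC.sqrt X) ⁻¹' Metric.closedBall 0 1) := by
  ext v
  simp only [ellipsoid, Set.mem_ofPred_eq, Set.mem_preimage, mem_closedBall_zero_iff]
  rw [inner_toEuclideanLin, ← norm_sq_toEuclideanLin_sqrt hX, ← sub_eq_add_neg,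
    sq_le_one_iff₀ (norm_nonneg _)]

theorem linearMap_det_toEuclideanLin (X : Matrix (Fin N) (Fin N) ℝ) :
    LinearMap.det (toEuclideanLin X) = X.det := by
  rw [toEuclideanLin_eq_toLin_orthonormal, LinearMap.det_toLin]

theorem volume_ellipsoid (hX : X.PosDef) (c : EuclideanSpace ℝ (Fin N)) :
    MeasureTheory.volume (ellipsoid X c) = ENNReal.ofReal (√X.det)⁻¹ *
      MeasureTheory.volume (Metric.closedBall (0 : EuclideanSpace ℝ (Fin N)) 1) := by
  have hdet : LinearMap.det (toEuclideanLin (CFC.sqrt X)) = √X.det := by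
    rw [linearMap_det_toEuclideanLin, det_sqrt_eq hX]
  have hpos : 0 < √X.det := Real.sqrt_pos.2 hX.det_pos
  rw [ellipsoid_eq_preimage hX, MeasureTheory.measure_preimage_add_right,
    MeasureTheory.Measure.addHaar_preimage_linearMap _ (by rw [hdet]; exact hpos.ne'), hdet,
    abs_of_nonneg (by positivity)]

theorem volume_closedBall_ne_zero :
    MeasureTheory.volume (Metric.closedBall (0 : EuclideanSpace ℝ (Fin N)) 1) ≠ 0 :=
  (Metric.measure_closedBall_pos _ _ one_pos).ne'

theorem volume_closedBall_ne_top :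
    MeasureTheory.volume (Metric.closedBall (0 : EuclideanSpace ℝ (Fin N)) 1) ≠ ⊤ :=
  MeasureTheory.measure_closedBall_lt_top.ne

theorem normalizedVolume_ellipsoid (hX : X.PosDef) (c : EuclideanSpace ℝ (Fin N)) :
    normalizedVolume (ellipsoid X c) = (√X.det)⁻¹ := by
  rw [normalizedVolume, volume_ellipsoid hX, ENNReal.toReal_mul,
    ENNReal.toReal_ofReal (by positivity), mul_div_cancel_right₀]
  exact (ENNReal.toReal_pos volume_closedBall_ne_zero volume_closedBall_ne_top).ne'

theorem volume_ellipsoid_le_iff {Y : Matrix (Fin N) (Fin N) ℝ} (hX : X.PosDef) (hY : Y.PosDef)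
    (c e : EuclideanSpace ℝ (Fin N)) :
    MeasureTheory.volume (ellipsoid X c) ≤ MeasureTheory.volume (ellipsoid Y e) ↔
      Y.det ≤ X.det := by
  have hx := Real.sqrt_pos.2 hX.det_pos
  have hy := Real.sqrt_pos.2 hY.det_pos
  rw [volume_ellipsoid hX, volume_ellipsoid hY,
    ENNReal.mul_le_mul_iff_left volume_closedBall_ne_zero volume_closedBall_ne_top,
    ENNReal.ofReal_le_ofReal_iff (by positivity), inv_le_inv₀ hx hy,
    Real.sqrt_le_sqrt_iff hX.det_pos.le]

/-- The vectors of `Φ` satisfy `⟨X φ, φ⟩ ≤ 1`. -/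
def Inscribed (Φ : Fin M → EuclideanSpace ℝ (Fin N)) (X : Matrix (Fin N) (Fin N) ℝ) : Prop :=
  ∀ i, (Φ i).ofLp ⬝ᵥ X *ᵥ (Φ i).ofLp ≤ 1

theorem convexHull_subset_ellipsoid (hX : X.PosDef) (h : Inscribed Φ X) :
    convexHull ℝ (symmetrized Φ) ⊆ ellipsoid X 0 := by
  refine convexHull_min ?_ ?_
  · rintro _ (⟨i, rfl⟩ | ⟨i, rfl⟩)
    · simpa [ellipsoid, inner_toEuclideanLin] using h i
    · simpa [ellipsoid, inner_toEuclideanLin, mulVec_neg] using h i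
  · rw [ellipsoid_eq_preimage hX]
    simpa using (convex_closedBall _ _).linear_preimage _

theorem inscribed_of_convexHull_subset (hX : X.PosDef) {c : EuclideanSpace ℝ (Fin N)}
    (h : convexHull ℝ (symmetrized Φ) ⊆ ellipsoid X c) : Inscribed Φ X := by
  intro i
  have h1 := h (subset_convexHull ℝ _ (Or.inl ⟨i, rfl⟩))
  have h2 := h (subset_convexHull ℝ _ (Or.inr ⟨i, rfl⟩))
  -- Adding the conditions at `φ` and `-φ` cancels the terms linear in the centre and leaves `⟨X φ,
  -- φ⟩ + ⟨X c, c⟩ ≤ 1`.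
  have h3 := hX.posSemidef.dotProduct_mulVec_nonneg c.ofLp
  simp only [ellipsoid, Set.mem_ofPred_eq, inner_toEuclideanLin, WithLp.ofLp_sub,
    WithLp.ofLp_neg, mulVec_sub, mulVec_neg, dotProduct_sub, sub_dotProduct, neg_dotProduct,
    dotProduct_neg, star_trivial] at h1 h2 h3
  linarith

theorem isMinimalEllipsoidOf_ellipsoid_iff (hX : X.PosDef) :
    IsMinimalEllipsoidOf Φ (ellipsoid X 0) ↔
      Inscribed Φ X ∧ ∀ Y : Matrix (Fin N) (Fin N) ℝ, Y.PosDef → Inscribed Φ Y →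
        Y.det ≤ X.det := by
  constructor
  · intro h
    refine ⟨inscribed_of_convexHull_subset hX h.subset, fun Y hY hΦ => ?_⟩
    rw [← volume_ellipsoid_le_iff hX hY 0 0]
    exact h.volume_le Y 0 hY (convexHull_subset_ellipsoid hY hΦ)
  · rintro ⟨h, hmax⟩
    refine ⟨⟨X, 0, hX, rfl⟩, convexHull_subset_ellipsoid hX h, fun Y c hY hΦ => ?_⟩
    rw [volume_ellipsoid_le_iff hX hY]
    exact hmax Y hY (inscribed_of_convexHull_subset hY hΦ)

/-! ### Existence of the minimal ellipsoid -/

theorem exists_det_maximizer (hΦ : IsUnitNormFrame Φ) :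
    ∃ X : Matrix (Fin N) (Fin N) ℝ, X.PosDef ∧ Inscribed Φ X ∧
      ∀ Y : Matrix (Fin N) (Fin N) ℝ, Y.PosDef → Inscribed Φ Y → Y.det ≤ X.det := by
  obtain ⟨⟨A, B, hA, -, hAB⟩, hunit⟩ := hΦ
  have hq : ∀ (R : Matrix (Fin N) (Fin N) ℝ) (v : Fin N → ℝ),
      v ⬝ᵥ (Rᵀ * R) *ᵥ v = (R *ᵥ v) ⬝ᵥ (R *ᵥ v) := fun R v => by
    rw [← mulVec_mulVec, dotProduct_mulVec, vecMul_transpose]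
  -- With `X = Rᵀ R` the feasible set is closed, and the lower frame bound confines each row of `R`.
  -- The identity is feasible, so a maximizer has determinant at least 1 and is definite.
  set S : Set (Matrix (Fin N) (Fin N) ℝ) := {R | Inscribed Φ (Rᵀ * R)} with hS
  have hclosed : IsClosed S := by
    simp only [hS, Inscribed, Set.ofPred_forall]
    refine isClosed_iInter fun i => isClosed_le ?_ continuous_const
    fun_prop
  have hbdd : S ⊆ Set.univ.pi fun _ => Set.univ.pi fun _ =>
      Set.Icc (-(M / A + 1)) (M / A + 1) := by
    intro R hR k _ l _
    have hrow : A * (R k l) ^ 2 ≤ M := by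
      calc A * (R k l) ^ 2 ≤ A * ‖WithLp.toLp 2 (R k)‖ ^ 2 := by
            refine mul_le_mul_of_nonneg_left ?_ hA.le
            rw [EuclideanSpace.real_norm_sq_eq]
            exact Finset.single_le_sum (f := fun j => R k j ^ 2) (fun _ _ => sq_nonneg _)
              (Finset.mem_univ l)
        _ ≤ ∑ i, |inner ℝ (WithLp.toLp 2 (R k)) (Φ i)| ^ 2 := (hAB _).1
        _ ≤ ∑ i : Fin M, 1 := by
            refine Finset.sum_le_sum fun i _ => ?_
            refine le_trans ?_ ((hq R _).symm.le.trans (hR i))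
            rw [sq_abs, EuclideanSpace.inner_eq_star_dotProduct]
            have : (Φ i).ofLp ⬝ᵥ star (R k) = (R *ᵥ (Φ i).ofLp) k := by
              rw [star_trivial, dotProduct_comm]; rfl
            rw [this, sq]
            exact Finset.single_le_sum
              (f := fun j => (R *ᵥ (Φ i).ofLp) j * (R *ᵥ (Φ i).ofLp) j)
              (fun _ _ => mul_self_nonneg _) (Finset.mem_univ k)
        _ = M := by simp
    have h2 : (R k l) ^ 2 ≤ M / A := by rwa [le_div_iff₀' hA]
    rw [Set.mem_Icc, ← abs_le]
    refine abs_le_of_sq_le_sq ?_ (by positivity)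
    nlinarith [show 0 ≤ M / A by positivity]
  have hcomp : IsCompact S :=
    (isCompact_univ_pi fun _ => isCompact_univ_pi fun _ => isCompact_Icc).of_isClosed_subset
      hclosed hbdd
  have h1 : (1 : Matrix (Fin N) (Fin N) ℝ) ∈ S := by
    intro i
    simp [dotProduct_self_eq_norm_sq, hunit i]
  obtain ⟨R, hR, hmax⟩ := hcomp.exists_isMaxOn ⟨1, h1⟩
    (f := fun R : Matrix (Fin N) (Fin N) ℝ => (Rᵀ * R).det) (by fun_prop)
  have hdet : 1 ≤ (Rᵀ * R).det := by simpa using hmax h1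
  refine ⟨Rᵀ * R, ?_, hR, fun Y hY hYΦ => ?_⟩
  · rw [← conjTranspose_eq_transpose_of_trivial] at hdet ⊢
    refine PosDef.conjTranspose_mul_self _ ?_
    rw [mulVec_injective_iff_isUnit, isUnit_iff_isUnit_det, isUnit_iff_ne_zero]
    intro h0
    rw [det_mul, h0] at hdet
    norm_num at hdet
  · have hmem : CFC.sqrt Y ∈ S := by
      rw [hS, Set.mem_ofPred_eq, transpose_sqrt, sqrt_mul_sqrt hY]
      exact hYΦ
    have := isMaxOn_iff.1 hmax _ hmem
    simpa only [transpose_sqrt, sqrt_mul_sqrt hY] using this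

/-! ### First-order optimality and separation -/

theorem mulVec_dotProduct_mulVec_le (A : Matrix (Fin N) (Fin N) ℝ) (v : Fin N → ℝ) :
    (A *ᵥ v) ⬝ᵥ (A *ᵥ v) ≤ (∑ i, ∑ j, A i j ^ 2) * (v ⬝ᵥ v) := by
  simp only [dotProduct, Finset.sum_mul (s := Finset.univ) (f := fun i => ∑ j, A i j ^ 2), ← sq]
  refine Finset.sum_le_sum fun i _ => ?_
  exact Finset.sum_mul_sq_le_sq_mul_sq Finset.univ (fun j => A i j) v

theorem abs_dotProduct_mulVec_le (A : Matrix (Fin N) (Fin N) ℝ) (v : Fin N → ℝ) :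
    |v ⬝ᵥ A *ᵥ v| ≤ √(∑ i, ∑ j, A i j ^ 2) * (v ⬝ᵥ v) := by
  have h0 : 0 ≤ v ⬝ᵥ v := by simpa using dotProduct_star_self_nonneg v
  refine abs_le_of_sq_le_sq ?_ (by positivity)
  have h1 : (v ⬝ᵥ A *ᵥ v) ^ 2 ≤ (v ⬝ᵥ v) * ((A *ᵥ v) ⬝ᵥ (A *ᵥ v)) := by
    simpa only [dotProduct, ← sq] using Finset.sum_mul_sq_le_sq_mul_sq Finset.univ v (A *ᵥ v)
  have h2 := mul_le_mul_of_nonneg_left (mulVec_dotProduct_mulVec_le A v) h0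
  rw [mul_pow, Real.sq_sqrt (by positivity)]
  linarith

theorem isUnit_sqrt (hX : X.PosDef) : IsUnit (CFC.sqrt X) := by
  rw [isUnit_iff_isUnit_det, isUnit_iff_ne_zero, det_sqrt_eq hX]
  exact (Real.sqrt_pos.2 hX.det_pos).ne'

theorem eventually_posDef_add_smul (hX : X.PosDef) {G : Matrix (Fin N) (Fin N) ℝ}
    (hG : G.IsSymm) : ∀ᶠ t in 𝓝 (0 : ℝ), (X + t • G).PosDef := by
  set F := ∑ i, ∑ j, (CFC.sqrt X)⁻¹ i j ^ 2
  set c := √(∑ i, ∑ j, G i j ^ 2)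
  have hF : ∀ v : Fin N → ℝ, v ⬝ᵥ v ≤ F * (v ⬝ᵥ X *ᵥ v) := by
    intro v
    have h := mulVec_dotProduct_mulVec_le (CFC.sqrt X)⁻¹ (CFC.sqrt X *ᵥ v)
    have hq : (CFC.sqrt X *ᵥ v) ⬝ᵥ (CFC.sqrt X *ᵥ v) = v ⬝ᵥ X *ᵥ v := by
      conv_rhs => rw [← sqrt_mul_sqrt hX, ← mulVec_mulVec, dotProduct_mulVec, ← mulVec_transpose,
        transpose_sqrt]
    rwa [mulVec_mulVec, nonsing_inv_mul _ ((isUnit_iff_isUnit_det _).1 (isUnit_sqrt hX)),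
      one_mulVec, hq] at h
  have hev : ∀ᶠ t in 𝓝 (0 : ℝ), |t| * (c * F) < 1 := by
    have : Tendsto (fun t : ℝ => |t| * (c * F)) (𝓝 0) (𝓝 (|0| * (c * F))) :=
      (continuous_abs.mul continuous_const).tendsto _
    rw [abs_zero, zero_mul] at this
    exact this.eventually_lt_const one_pos
  filter_upwards [hev] with t ht
  have hXs : Xᵀ = X := by
    rw [← conjTranspose_eq_transpose_of_trivial]; exact hX.isHermitian
  refine PosDef.of_dotProduct_mulVec_pos ?_ fun v hv => ?_
  · rw [IsHermitian, conjTranspose_eq_transpose_of_trivial, transpose_add, transpose_smul, hXs,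
      hG.eq]
  · have hq : 0 < v ⬝ᵥ X *ᵥ v := by simpa using hX.dotProduct_mulVec_pos hv
    have h1 : |v ⬝ᵥ G *ᵥ v| ≤ c * F * (v ⬝ᵥ X *ᵥ v) := by
      rw [mul_assoc]
      exact (abs_dotProduct_mulVec_le G v).trans
        (mul_le_mul_of_nonneg_left (hF v) (Real.sqrt_nonneg _))
    have h2 : |t * (v ⬝ᵥ G *ᵥ v)| ≤ |t| * (c * F) * (v ⬝ᵥ X *ᵥ v) := by
      rw [abs_mul, mul_assoc]
      exact mul_le_mul_of_nonneg_left h1 (abs_nonneg t)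
    have h3 : |t| * (c * F) * (v ⬝ᵥ X *ᵥ v) < v ⬝ᵥ X *ᵥ v := mul_lt_of_lt_one_left hq ht
    have h4 := (abs_le.1 h2).1
    simp only [star_trivial, add_mulVec, smul_mulVec, dotProduct_add, dotProduct_smul,
      smul_eq_mul]
    linarith

/-- First-order optimality: a linear functional that strictly separates would produce a better
inscribed matrix. -/
theorem trace_mul_inv_le_of_maximizer (hN : 1 ≤ N) (hX : X.PosDef)
    (hΦ : Inscribed Φ X)
    (hmax : ∀ Y : Matrix (Fin N) (Fin N) ℝ, Y.PosDef → Inscribed Φ Y → Y.det ≤ X.det)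
    {G : Matrix (Fin N) (Fin N) ℝ} (hG : G.IsSymm) {u : ℝ}
    (hu : ∀ i, (Φ i).ofLp ⬝ᵥ G *ᵥ (Φ i).ofLp < u) : (G * X⁻¹).trace ≤ N * u := by
  by_contra! hlt
  have hN0 : (0 : ℝ) < N := by exact_mod_cast hN
  have hXdet : IsUnit X.det := isUnit_iff_ne_zero.2 hX.det_pos.ne'
  have hXs : Xᵀ = X := by
    rw [← conjTranspose_eq_transpose_of_trivial]; exact hX.isHermitian
  set τ := (G * X⁻¹).trace / N with hτ
  have hδ : 0 < τ - u := by
    rw [sub_pos, hτ, lt_div_iff₀ hN0, mul_comm]; exact hlt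
  set δ := τ - u with hδdef
  -- Removing the component along `X` makes `tr (X⁻¹ H) = 0`, so `det (X + t H)` changes only at
  -- order `t²`. The constraints drop to `1 - t δ`, and rescaling gains at first order in `t`.
  set H := G - τ • X with hH
  have hHs : H.IsSymm := by
    rw [IsSymm, hH, transpose_sub, transpose_smul, hXs, hG.eq]
  have htr : (X⁻¹ * H).trace = 0 := by
    rw [hH, mul_sub, mul_smul_comm, nonsing_inv_mul _ hXdet, trace_sub, trace_smul, trace_one,
      trace_mul_comm, hτ, Fintype.card_fin, smul_eq_mul, div_mul_cancel₀ _ hN0.ne', sub_self]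
  set q : ℝ → ℝ := fun t => (det (1 + (Polynomial.X : Polynomial ℝ) •
    (X⁻¹ * H).map Polynomial.C)).divX.divX.eval t with hq
  have hdet : ∀ t : ℝ, (X + t • H).det = X.det * (1 + q t * t ^ 2) := by
    intro t
    have h1 : X + t • H = X * (1 + t • (X⁻¹ * H)) := by
      rw [mul_add, mul_one, mul_smul_comm, ← mul_assoc, mul_nonsing_inv _ hXdet, one_mul]
    rw [h1, det_mul, det_one_add_smul, htr, zero_mul, add_zero]
  have hqc : Continuous q := Polynomial.continuous _
  have e1 := eventually_posDef_add_smul hX hHs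
  have e2 : ∀ᶠ t in 𝓝 (0 : ℝ), 0 < δ + t * q t := by
    have : Tendsto (fun t : ℝ => δ + t * q t) (𝓝 0) (𝓝 (δ + 0 * q 0)) :=
      (continuous_const.add (continuous_id.mul hqc)).tendsto _
    rw [zero_mul, add_zero] at this
    exact this.eventually_const_lt hδ
  have e3 : ∀ᶠ t in 𝓝 (0 : ℝ), t * δ < 1 := by
    have : Tendsto (fun t : ℝ => t * δ) (𝓝 0) (𝓝 (0 * δ)) :=
      (continuous_id.mul continuous_const).tendsto _
    rw [zero_mul] at this
    exact this.eventually_lt_const one_pos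
  have e4 : ∀ᶠ t in 𝓝 (0 : ℝ), t * τ < 1 := by
    have : Tendsto (fun t : ℝ => t * τ) (𝓝 0) (𝓝 (0 * τ)) :=
      (continuous_id.mul continuous_const).tendsto _
    rw [zero_mul] at this
    exact this.eventually_lt_const one_pos
  have hall := ((e1.and e2).and (e3.and e4)).filter_mono
    (nhdsWithin_le_nhds : 𝓝[>] (0 : ℝ) ≤ 𝓝 0)
  obtain ⟨t, ⟨⟨hpd, h2⟩, h3, h4⟩, ht⟩ := (hall.and self_mem_nhdsWithin).exists
  have ht : 0 < t := ht
  have hr : 0 < 1 - t * δ := by linarith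
  have hY := hpd.smul (inv_pos.2 hr)
  have hYΦ : Inscribed Φ ((1 - t * δ)⁻¹ • (X + t • H)) := by
    intro i
    rw [smul_mulVec, dotProduct_smul, smul_eq_mul, inv_mul_le_iff₀ hr, mul_one, hH]
    simp only [add_mulVec, sub_mulVec, smul_mulVec, dotProduct_add, dotProduct_sub,
      dotProduct_smul, smul_eq_mul]
    have a1 := mul_le_mul_of_nonneg_left (hΦ i) (sub_nonneg.2 h4.le)
    have a2 := mul_le_mul_of_nonneg_left (hu i).le ht.le
    rw [hδdef]
    nlinarith
  have hle := hmax _ hY hYΦ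
  rw [det_smul, hdet, Fintype.card_fin, inv_pow, inv_mul_le_iff₀ (by positivity), mul_comm,
    mul_le_mul_iff_of_pos_right hX.det_pos] at hle
  have hp : (1 - t * δ) ^ N ≤ 1 - t * δ :=
    pow_le_of_le_one hr.le (by nlinarith) (by lia)
  nlinarith [mul_pos ht h2]

theorem smul_inv_mem_convexHull (hN : 1 ≤ N) (hX : X.PosDef) (hΦ : Inscribed Φ X)
    (hmax : ∀ Y : Matrix (Fin N) (Fin N) ℝ, Y.PosDef → Inscribed Φ Y → Y.det ≤ X.det) :
    (N : ℝ)⁻¹ • X⁻¹ ∈ convexHull ℝ (Set.range fun i => vecMulVec (Φ i).ofLp (Φ i).ofLp) := by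
  have hN0 : (0 : ℝ) < N := by exact_mod_cast hN
  by_contra hnot
  have : LocallyConvexSpace ℝ (Matrix (Fin N) (Fin N) ℝ) :=
    inferInstanceAs (LocallyConvexSpace ℝ (Fin N → Fin N → ℝ))
  obtain ⟨f, u, hf, hfu⟩ := geometric_hahn_banach_closed_point (convex_convexHull ℝ _)
    ((Set.finite_range fun i => vecMulVec (Φ i).ofLp (Φ i).ofLp).isCompact_convexHull ℝ).isClosed
    hnot
  -- The separating functional is needed only on symmetric matrices, where it is the trace pairing
  -- with its symmetrization.
  set G : Matrix (Fin N) (Fin N) ℝ :=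
    Matrix.of fun a b => (f (single a b 1) + f (single b a 1)) / 2 with hGdef
  have hG : G.IsSymm := by
    ext a b
    simp [hGdef, add_comm]
  have hfG : ∀ Z : Matrix (Fin N) (Fin N) ℝ, Z.IsSymm → f Z = (G * Z).trace := by
    intro Z hZ
    have h1 : f Z = ∑ a, ∑ b, Z a b * f (single a b 1) := by
      conv_lhs => rw [matrix_eq_sum_single Z]
      rw [map_sum]
      refine Finset.sum_congr rfl fun a _ => ?_
      rw [map_sum]
      refine Finset.sum_congr rfl fun b _ => ?_
      rw [← smul_eq_mul (Z a b), ← map_smul, smul_single, smul_eq_mul, mul_one]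
    have h2 : f Z = ∑ a, ∑ b, Z a b * f (single b a 1) := by
      rw [h1, Finset.sum_comm]
      exact Finset.sum_congr rfl fun a _ => Finset.sum_congr rfl fun b _ => by rw [hZ.apply]
    have h3 : (G * Z).trace = ∑ a, ∑ b, Z a b * ((f (single a b 1) + f (single b a 1)) / 2) := by
      simp only [trace, diag_apply, mul_apply, hGdef, of_apply]
      exact Finset.sum_congr rfl fun a _ => Finset.sum_congr rfl fun b _ => by
        rw [hZ.apply, mul_comm]
    have h4 : ∑ a, ∑ b, Z a b * ((f (single a b 1) + f (single b a 1)) / 2) =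
        (∑ a, ∑ b, Z a b * f (single a b 1) + ∑ a, ∑ b, Z a b * f (single b a 1)) / 2 := by
      rw [← Finset.sum_add_distrib, Finset.sum_div]
      refine Finset.sum_congr rfl fun a _ => ?_
      rw [← Finset.sum_add_distrib, Finset.sum_div]
      exact Finset.sum_congr rfl fun b _ => by ring
    rw [h3, h4, ← h1, ← h2]
    ring
  have hXs : X⁻¹.IsSymm := by
    rw [IsSymm, ← conjTranspose_eq_transpose_of_trivial]
    exact hX.inv.isHermitian
  have hle := trace_mul_inv_le_of_maximizer hN hX hΦ hmax hG (u := u) fun i => by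
    rw [← trace_mul_vecMulVec_self, ← hfG _ (transpose_vecMulVec _ _)]
    exact hf _ (subset_convexHull ℝ _ ⟨i, rfl⟩)
  rw [map_smul, hfG _ hXs, smul_eq_mul, lt_inv_mul_iff₀ hN0] at hfu
  linarith

/-! ### Weights and contact points -/

theorem trace_vecMulVec_self (v : EuclideanSpace ℝ (Fin N)) :
    (vecMulVec v.ofLp v.ofLp).trace = ‖v‖ ^ 2 := by
  rw [trace_vecMulVec, dotProduct_self_eq_norm_sq]

/-- Affinely independent rank-one projections are linearly independent in the space of symmetric
matrices. -/
theorem card_le_of_affineIndependent_vecMulVec {ι : Type*} [Fintype ι]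
    {v : ι → EuclideanSpace ℝ (Fin N)} (hv : ∀ i, ‖v i‖ = 1)
    (h : AffineIndependent ℝ fun i => vecMulVec (v i).ofLp (v i).ofLp) :
    Fintype.card ι ≤ N * (N + 1) / 2 := by
  -- Unordered index pairs are coordinates on symmetric matrices, whence the dimension `N (N + 1) /
  -- 2`. All traces being 1, a linear relation has coefficients summing to zero, so it is an affine
  -- one.
  let y : ι → Sym2 (Fin N) → ℝ := fun i =>
    Sym2.lift ⟨fun a b => v i a * v i b, fun a b => mul_comm _ _⟩
  have hy : LinearIndependent ℝ y := by
    rw [Fintype.linearIndependent_iff]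
    intro g hg
    have h1 : ∑ i, g i • vecMulVec (v i).ofLp (v i).ofLp = 0 := by
      ext a b
      have := congrFun hg s(a, b)
      simpa [y, Matrix.sum_apply, vecMulVec_apply] using this
    have h2 : ∑ i, g i = 0 := by
      have := congrArg trace h1
      simpa [trace_sum, trace_vecMulVec_self, hv, -trace_vecMulVec] using this
    exact fun i => h.eq_zero_of_sum_eq_zero h2 h1 i (Finset.mem_univ i)
  have := hy.fintype_card_le_finrank
  rw [Module.finrank_fintype_fun_eq_card, Sym2.card, Fintype.card_fin, Nat.choose_two_right,
    Nat.add_sub_cancel, mul_comm] at this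
  exact this

theorem exists_isWeight (hN : 1 ≤ N) (hX : X.PosDef) (hunit : ∀ i, ‖Φ i‖ = 1)
    (hΦ : Inscribed Φ X)
    (hmax : ∀ Y : Matrix (Fin N) (Fin N) ℝ, Y.PosDef → Inscribed Φ Y → Y.det ≤ X.det) :
    ∃ ρ : Fin M → ℝ, IsWeight Φ X ρ := by
  classical
  have hN0 : (0 : ℝ) < N := by exact_mod_cast hN
  -- Carathéodory's affinely independent points give both bounds in `K`: they are distinct members
  -- of the range, and their number obeys the dimension bound.
  obtain ⟨ι, hι, z, w, hz, haff, hw, -, hsum⟩ :=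
    eq_pos_convex_span_of_mem_convexHull (smul_inv_mem_convexHull hN hX hΦ hmax)
  have hz' : ∀ j, ∃ i, vecMulVec (Φ i).ofLp (Φ i).ofLp = z j := fun j => hz ⟨j, rfl⟩
  choose idx hidx using hz'
  obtain rfl : (fun j => vecMulVec (Φ (idx j)).ofLp (Φ (idx j)).ofLp) = z := funext hidx
  have hcard := card_le_of_affineIndependent_vecMulVec (fun j => hunit (idx j)) haff
  have hcard' : Fintype.card ι ≤ M := by
    have hinj : Function.Injective idx := fun a b hab => haff.injective (by simp only [hab])
    simpa using Fintype.card_le_of_injective idx hinj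
  refine ⟨fun i => ∑ j, if idx j = i then N * w j else 0, fun i => ?_, ?_, ?_⟩
  · exact Finset.sum_nonneg fun j _ => by
      split_ifs
      · exact mul_nonneg hN0.le (hw j).le
      · exact le_rfl
  · have hsub : (Finset.univ.filter fun i => 0 < ∑ j, if idx j = i then N * w j else 0) ⊆
        Finset.univ.image idx := by
      intro i hi
      obtain ⟨j, -, hj⟩ := Finset.exists_ne_zero_of_sum_ne_zero (Finset.mem_filter.1 hi).2.ne'
      exact Finset.mem_image.2 ⟨j, Finset.mem_univ j, by_contra fun hne => hj (if_neg hne)⟩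
    refine (Finset.card_le_card hsub).trans (Finset.card_image_le.trans ?_)
    exact le_min hcard' hcard
  · have h1 : X⁻¹ = ∑ j, (N * w j) • vecMulVec (Φ (idx j)).ofLp (Φ (idx j)).ofLp := by
      simp only [mul_smul, ← Finset.smul_sum]
      rw [hsum, smul_smul, mul_inv_cancel₀ hN0.ne', one_smul]
    rw [h1]
    simp only [Finset.sum_smul]
    rw [Finset.sum_comm]
    refine Finset.sum_congr rfl fun j _ => ?_
    simp [ite_smul]

theorem trace_inv_eq_sum_of_isWeight (hunit : ∀ i, ‖Φ i‖ = 1) {ρ : Fin M → ℝ}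
    (hρ : IsWeight Φ X ρ) : X⁻¹.trace = ∑ i, ρ i := by
  rw [hρ.inv_eq, trace_sum]
  simp [trace_smul, trace_vecMulVec_self, hunit, -trace_vecMulVec]

theorem sum_weight_mul_eq (hX : X.PosDef) {ρ : Fin M → ℝ} (hρ : IsWeight Φ X ρ) :
    ∑ i, ρ i * ((Φ i).ofLp ⬝ᵥ X *ᵥ (Φ i).ofLp) = N := by
  have h : (X * X⁻¹).trace = N := by
    rw [mul_nonsing_inv _ (isUnit_iff_ne_zero.2 hX.det_pos.ne'), trace_one, Fintype.card_fin]
  rw [hρ.inv_eq, Finset.mul_sum, trace_sum] at h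
  simpa [mul_smul_comm, trace_mul_vecMulVec_self] using h

theorem trace_inv_eq (hN : 1 ≤ N) (hX : X.PosDef) (hunit : ∀ i, ‖Φ i‖ = 1)
    (hΦ : Inscribed Φ X)
    (hmax : ∀ Y : Matrix (Fin N) (Fin N) ℝ, Y.PosDef → Inscribed Φ Y → Y.det ≤ X.det) :
    X⁻¹.trace = N := by
  have hN0 : (0 : ℝ) < N := by exact_mod_cast hN
  have hsub : (Set.range fun i => vecMulVec (Φ i).ofLp (Φ i).ofLp) ⊆
      (traceLinearMap (Fin N) ℝ ℝ) ⁻¹' {1} := by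
    rintro _ ⟨i, rfl⟩
    simp only [Set.mem_preimage, traceLinearMap_apply, Set.mem_singleton_iff]
    rw [trace_vecMulVec_self, hunit i, one_pow]
  have h := convexHull_min hsub ((convex_singleton 1).linear_preimage _)
    (smul_inv_mem_convexHull hN hX hΦ hmax)
  simp only [Set.mem_preimage, traceLinearMap_apply, Set.mem_singleton_iff, trace_smul,
    smul_eq_mul] at h
  rwa [inv_mul_eq_one₀ hN0.ne', eq_comm] at h

/-- Complementary slackness: the nonnegative terms `ρ i * (1 - ⟨X φ_i, φ_i⟩)` sum to `tr X⁻¹ - N =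
0`. -/
theorem quad_eq_one_of_isWeight (hX : X.PosDef) (hunit : ∀ i, ‖Φ i‖ = 1) (hΦ : Inscribed Φ X)
    (htr : X⁻¹.trace = N) {ρ : Fin M → ℝ} (hρ : IsWeight Φ X ρ) {i : Fin M} (hi : 0 < ρ i) :
    (Φ i).ofLp ⬝ᵥ X *ᵥ (Φ i).ofLp = 1 := by
  have h0 : ∑ i, ρ i * (1 - (Φ i).ofLp ⬝ᵥ X *ᵥ (Φ i).ofLp) = 0 := by
    simp only [mul_sub, mul_one, Finset.sum_sub_distrib]
    rw [sum_weight_mul_eq hX hρ, ← trace_inv_eq_sum_of_isWeight hunit hρ, htr, sub_self]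
  have h1 := (Finset.sum_eq_zero_iff_of_nonneg fun i _ =>
    mul_nonneg (hρ.nonneg i) (sub_nonneg.2 (hΦ i))).1 h0 i (Finset.mem_univ i)
  rcases mul_eq_zero.1 h1 with h | h <;> linarith

/-! ### Trace and determinant inequalities -/

theorem det_le_one_of_trace_le {S : Matrix (Fin N) (Fin N) ℝ} (hS : S.PosSemidef)
    (htr : S.trace ≤ N) : S.det ≤ 1 := by
  have h1 : S.det = ∏ i, hS.isHermitian.eigenvalues i := by
    simpa using hS.isHermitian.det_eq_prod_eigenvalues
  have h2 : S.trace = ∑ i, hS.isHermitian.eigenvalues i := by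
    simpa using hS.isHermitian.trace_eq_sum_eigenvalues
  calc S.det ≤ ∏ i, Real.exp (hS.isHermitian.eigenvalues i - 1) := by
        rw [h1]
        refine Finset.prod_le_prod (fun i _ => hS.eigenvalues_nonneg i) fun i _ => ?_
        linarith [Real.add_one_le_exp (hS.isHermitian.eigenvalues i - 1)]
    _ = Real.exp (S.trace - N) := by
        rw [← Real.exp_sum, Finset.sum_sub_distrib, h2]; simp
    _ ≤ 1 := by rw [Real.exp_le_one_iff]; linarith

/-- AM-GM for the eigenvalues of `X^{1/2} S X^{1/2}`, whose trace is that of `X * S`. -/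
theorem det_mul_det_le_one {S : Matrix (Fin N) (Fin N) ℝ} (hX : X.PosDef) (hS : S.PosSemidef)
    (htr : (X * S).trace ≤ N) : X.det * S.det ≤ 1 := by
  have hpsd : (CFC.sqrt X * S * CFC.sqrt X).PosSemidef := by
    have := hS.mul_mul_conjTranspose_same (CFC.sqrt X)
    rwa [conjTranspose_eq_transpose_of_trivial, transpose_sqrt] at this
  have h := det_le_one_of_trace_le hpsd (by
    rwa [trace_mul_comm, ← mul_assoc, sqrt_mul_sqrt hX])
  rw [det_mul, det_mul, mul_right_comm, ← det_mul, sqrt_mul_sqrt hX] at h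
  exact h

theorem mul_le_trace_of_det_eq_pow {P : Matrix (Fin N) (Fin N) ℝ} (hP : P.PosDef) {v : ℝ}
    (hv : 0 < v) (hdet : P.det = v ^ N) : N * v ≤ P.trace := by
  have h1 : P.det = ∏ i, hP.isHermitian.eigenvalues i := by
    simpa using hP.isHermitian.det_eq_prod_eigenvalues
  have h2 : P.trace = ∑ i, hP.isHermitian.eigenvalues i := by
    simpa using hP.isHermitian.trace_eq_sum_eigenvalues
  have h3 : ∑ i, Real.log (hP.isHermitian.eigenvalues i / v) = 0 := by
    rw [← Real.log_prod fun i _ => (div_pos (hP.eigenvalues_pos i) hv).ne',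
      Finset.prod_div_distrib, ← h1, hdet, Finset.prod_const, Finset.card_univ, Fintype.card_fin,
      div_self (pow_pos hv N).ne', Real.log_one]
  have h4 : ∑ i, Real.log (hP.isHermitian.eigenvalues i / v) ≤
      ∑ i, (hP.isHermitian.eigenvalues i / v - 1) :=
    Finset.sum_le_sum fun i _ => Real.log_le_sub_one_of_pos (div_pos (hP.eigenvalues_pos i) hv)
  rw [h3, Finset.sum_sub_distrib, ← Finset.sum_div, ← h2] at h4
  simp only [Finset.sum_const, Finset.card_univ, Fintype.card_fin, nsmul_eq_mul, mul_one,
    sub_nonneg] at h4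
  rwa [le_div_iff₀ hv] at h4

theorem trace_mul_self_eq_sum {S : Matrix (Fin N) (Fin N) ℝ} (hS : S.IsHermitian) :
    (S * S).trace = ∑ i, hS.eigenvalues i ^ 2 := by
  conv_lhs => rw [hS.spectral_theorem, ← map_mul, Unitary.conjStarAlgAut_apply, trace_mul_comm,
    ← mul_assoc, Unitary.coe_star_mul_self, one_mul, diagonal_mul_diagonal, trace_diagonal]
  simp [sq]

theorem sum_sq_eq_trace_mul_self {S : Matrix (Fin N) (Fin N) ℝ} (hS : S.IsSymm) :
    ∑ i, ∑ j, S i j ^ 2 = (S * S).trace := by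
  simp only [trace, diag_apply, mul_apply, sq]
  exact Finset.sum_congr rfl fun i _ => Finset.sum_congr rfl fun j _ => by rw [hS.apply]

/-- The eigenvalue deviations from 1 sum to zero, so the loss in the determinant is quadratic. -/
theorem one_sub_le_det {S : Matrix (Fin N) (Fin N) ℝ} (hS : S.IsSymm) (htr : S.trace = N)
    (h : ∑ i, ∑ j, (S - 1) i j ^ 2 ≤ 1 / 2) : 1 - ∑ i, ∑ j, (S - 1) i j ^ 2 ≤ S.det := by
  have hH : S.IsHermitian := by
    rw [IsHermitian, conjTranspose_eq_transpose_of_trivial, hS.eq]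
  have h1 : S.det = ∏ i, hH.eigenvalues i := by simpa using hH.det_eq_prod_eigenvalues
  have h2 : S.trace = ∑ i, hH.eigenvalues i := by simpa using hH.trace_eq_sum_eigenvalues
  have h3 : ∑ i, ∑ j, (S - 1) i j ^ 2 = ∑ i, (hH.eigenvalues i - 1) ^ 2 := by
    have ha : ∑ i, ∑ j, (S - 1) i j ^ 2 = ((S - 1) * (S - 1)).trace :=
      sum_sq_eq_trace_mul_self (hS.sub isSymm_one)
    have hb : ((S - 1) * (S - 1)).trace = (S * S).trace - 2 * S.trace + N := by
      rw [sub_mul, mul_sub, mul_one, one_mul, trace_sub, trace_sub, trace_sub, trace_one,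
        Fintype.card_fin]
      ring
    have hc : ∑ i, (hH.eigenvalues i - 1) ^ 2 =
        ∑ i, hH.eigenvalues i ^ 2 - 2 * ∑ i, hH.eigenvalues i + N := by
      simp only [sub_sq, Finset.sum_add_distrib, Finset.sum_sub_distrib, Finset.mul_sum]
      simp
    rw [ha, hb, hc, trace_mul_self_eq_sum hH, h2]
  rw [h3] at h ⊢
  have h4 := one_sub_sum_sq_le_prod (fun i => hH.eigenvalues i - 1) (by
    rw [Finset.sum_sub_distrib, ← h2, htr]; simp) h
  simpa [h1] using h4

/-! ### Transferring weights from a nearby scalable frame -/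

theorem eq_one_of_forall_dotProduct_mulVec {T : Matrix (Fin N) (Fin N) ℝ} (hT : T.IsSymm)
    (h : ∀ x, x ⬝ᵥ T *ᵥ x = x ⬝ᵥ x) : T = 1 := by
  have hb : ∀ x y, x ⬝ᵥ T *ᵥ y = x ⬝ᵥ y := by
    intro x y
    have h1 := h (x + y)
    have h2 : y ⬝ᵥ T *ᵥ x = x ⬝ᵥ T *ᵥ y := by
      rw [dotProduct_mulVec, ← mulVec_transpose, hT.eq, dotProduct_comm]
    simp only [mulVec_add, add_dotProduct, dotProduct_add, h x, h y, h2, dotProduct_comm y x] at h1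
    linarith
  ext i j
  have := hb (Pi.single i 1) (Pi.single j 1)
  simpa [one_apply, Pi.single_apply, eq_comm] using this

theorem isSymm_sum_smul_vecMulVec (e : Fin M → ℝ) (Φ : Fin M → EuclideanSpace ℝ (Fin N)) :
    (∑ i, e i • vecMulVec (Φ i).ofLp (Φ i).ofLp).IsSymm := by
  simp [IsSymm, transpose_sum, transpose_smul, transpose_vecMulVec]

theorem dotProduct_sum_smul_vecMulVec_mulVec (e : Fin M → ℝ)
    (Φ : Fin M → EuclideanSpace ℝ (Fin N)) (x : Fin N → ℝ) :
    x ⬝ᵥ (∑ i, e i • vecMulVec (Φ i).ofLp (Φ i).ofLp) *ᵥ x =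
      ∑ i, e i * ((Φ i).ofLp ⬝ᵥ x) ^ 2 := by
  rw [sum_mulVec, dotProduct_sum]
  refine Finset.sum_congr rfl fun i _ => ?_
  rw [smul_mulVec, vecMulVec_mulVec, dotProduct_smul, dotProduct_smul, dotProduct_comm x]
  simp [sq]

theorem posSemidef_sum_smul_vecMulVec {e : Fin M → ℝ} (he : ∀ i, 0 ≤ e i)
    (Φ : Fin M → EuclideanSpace ℝ (Fin N)) :
    (∑ i, e i • vecMulVec (Φ i).ofLp (Φ i).ofLp).PosSemidef :=
  posSemidef_sum _ fun i _ => (by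
    simpa using posSemidef_vecMulVec_self_star (Φ i).ofLp : PosSemidef _).smul (he i)

theorem exists_weights_of_isScalable (hΨ : IsScalable Ψ) :
    ∃ c : Fin M → ℝ, (∀ i, 0 ≤ c i) ∧
      ∑ i, c i • vecMulVec (Ψ i).ofLp (Ψ i).ofLp = (1 : Matrix (Fin N) (Fin N) ℝ) := by
  obtain ⟨-, s, -, A, hA, h⟩ := hΨ
  refine ⟨fun i => s i ^ 2 / A, fun i => by positivity,
    eq_one_of_forall_dotProduct_mulVec (isSymm_sum_smul_vecMulVec _ _) fun x => ?_⟩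
  have hx := h (WithLp.toLp 2 x)
  rw [dotProduct_sum_smul_vecMulVec_mulVec]
  have h1 : x ⬝ᵥ x = ‖WithLp.toLp 2 x‖ ^ 2 := dotProduct_self_eq_norm_sq (WithLp.toLp 2 x)
  rw [h1, ← mul_right_inj' hA.ne', ← hx, Finset.mul_sum]
  refine Finset.sum_congr rfl fun i _ => ?_
  rw [sq_abs, inner_smul_right, EuclideanSpace.inner_eq_star_dotProduct]
  simp only [star_trivial]
  field_simp

theorem sum_sq_sub_vecMulVec (a b : ℝ) (φ ψ : EuclideanSpace ℝ (Fin N)) :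
    ‖WithLp.toLp 2 (fun p : Fin N × Fin N => a * (φ p.1 * φ p.2) - b * (ψ p.1 * ψ p.2))‖ ^ 2 =
      a ^ 2 * ‖φ‖ ^ 4 - 2 * (a * b * (inner ℝ φ ψ) ^ 2) + b ^ 2 * ‖ψ‖ ^ 4 := by
  have hφ : ‖φ‖ ^ 4 = (∑ i, φ i ^ 2) * ∑ j, φ j ^ 2 := by
    rw [← EuclideanSpace.real_norm_sq_eq]; ring
  have hψ : ‖ψ‖ ^ 4 = (∑ i, ψ i ^ 2) * ∑ j, ψ j ^ 2 := by
    rw [← EuclideanSpace.real_norm_sq_eq]; ring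
  have hi : (inner ℝ φ ψ) ^ 2 = (∑ i, φ i * ψ i) * ∑ j, φ j * ψ j := by
    rw [EuclideanSpace.inner_eq_star_dotProduct, sq, dotProduct_comm]
    simp [dotProduct]
  rw [EuclideanSpace.real_norm_sq_eq, hφ, hψ, hi, Finset.sum_mul_sum, Finset.sum_mul_sum,
    Finset.sum_mul_sum, Fintype.sum_prod_type]
  simp only [Finset.mul_sum, ← Finset.sum_add_distrib, ← Finset.sum_sub_distrib]
  exact Finset.sum_congr rfl fun i _ => Finset.sum_congr rfl fun j _ => by ring

/-- A scalable frame near the unit norm frame `Φ` yields weights for which the frame operator of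
`Φ` is close to the identity. -/
theorem exists_weights_near (hunit : ∀ i, ‖Φ i‖ = 1) (hΨ : IsScalable Ψ) :
    ∃ e : Fin M → ℝ, (∀ i, 0 ≤ e i) ∧ ∑ i, e i = N ∧
      ∑ a, ∑ b, ((∑ i, e i • vecMulVec (Φ i).ofLp (Φ i).ofLp) - 1 :
        Matrix (Fin N) (Fin N) ℝ) a b ^ 2 ≤ 2 * (N * frobeniusNorm (Φ - Ψ) ^ 2) := by
  obtain ⟨c, hc, hsum⟩ := exists_weights_of_isScalable hΨ
  have he0 : ∀ i, 0 ≤ c i * ‖Ψ i‖ ^ 2 := fun i => mul_nonneg (hc i) (sq_nonneg _)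
  have hquad : ∀ x : Fin N → ℝ, ∑ i, c i * ((Ψ i).ofLp ⬝ᵥ x) ^ 2 = x ⬝ᵥ x := fun x => by
    rw [← dotProduct_sum_smul_vecMulVec_mulVec, hsum, one_mulVec]
  -- Testing the resolution of the identity on `Ψ i` itself.
  have he1 : ∀ i, c i * ‖Ψ i‖ ^ 2 ≤ 1 := by
    intro i
    rcases (sq_nonneg ‖Ψ i‖).eq_or_lt with h0 | hpos
    · rw [← h0]; simp
    · have h1 : c i * ((Ψ i).ofLp ⬝ᵥ (Ψ i).ofLp) ^ 2 ≤ (Ψ i).ofLp ⬝ᵥ (Ψ i).ofLp := by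
        refine le_trans ?_ (hquad (Ψ i).ofLp).le
        exact Finset.single_le_sum (f := fun j => c j * ((Ψ j).ofLp ⬝ᵥ (Ψ i).ofLp) ^ 2)
          (fun j _ => mul_nonneg (hc j) (sq_nonneg _)) (Finset.mem_univ i)
      rw [dotProduct_self_eq_norm_sq] at h1
      nlinarith
  have hesum : ∑ i, c i * ‖Ψ i‖ ^ 2 = N := by
    have := congrArg trace hsum
    rw [trace_sum, trace_one, Fintype.card_fin] at this
    simpa [trace_smul, trace_vecMulVec_self, -trace_vecMulVec] using this
  refine ⟨fun i => c i * ‖Ψ i‖ ^ 2, he0, hesum, ?_⟩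
  have hsq : ∀ x : ℝ, (√2 * x) ^ 2 = 2 * x ^ 2 := fun x => by
    rw [mul_pow, Real.sq_sqrt (by norm_num)]
  let W : Fin M → EuclideanSpace ℝ (Fin N × Fin N) := fun i => WithLp.toLp 2 fun p =>
    (c i * ‖Ψ i‖ ^ 2) * (Φ i p.1 * Φ i p.2) - c i * (Ψ i p.1 * Ψ i p.2)
  have hW : ∀ i, ‖W i‖ ≤ (c i * ‖Ψ i‖ ^ 2) * (√2 * ‖Φ i - Ψ i‖) := by
    intro i
    refine le_of_sq_le_sq ?_ (mul_nonneg (he0 i) (by positivity))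
    rw [sum_sq_sub_vecMulVec, mul_pow _ (√2 * _), hsq, hunit i,
      norm_sub_sq_real, hunit i]
    -- With `e = c ‖ψ‖²`, the right side minus the left is exactly `2 e c (‖ψ‖² - ⟨φ, ψ⟩)²`.
    have := mul_nonneg (mul_nonneg (he0 i) (hc i))
      (sq_nonneg (‖Ψ i‖ ^ 2 - inner ℝ (Φ i) (Ψ i)))
    nlinarith
  have hnorm : ‖∑ i, W i‖ ^ 2 = ∑ a, ∑ b, ((∑ i, (c i * ‖Ψ i‖ ^ 2) •
      vecMulVec (Φ i).ofLp (Φ i).ofLp) - 1 : Matrix (Fin N) (Fin N) ℝ) a b ^ 2 := by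
    rw [EuclideanSpace.real_norm_sq_eq, Fintype.sum_prod_type, ← hsum]
    refine Finset.sum_congr rfl fun a _ => Finset.sum_congr rfl fun b _ => ?_
    congr 1
    simp [W, Matrix.sum_apply, vecMulVec_apply, Finset.sum_sub_distrib]
  rw [← hnorm]
  calc ‖∑ i, W i‖ ^ 2 ≤ (∑ i, (c i * ‖Ψ i‖ ^ 2) * (√2 * ‖Φ i - Ψ i‖)) ^ 2 := by
        gcongr
        exact (norm_sum_le _ _).trans (Finset.sum_le_sum fun i _ => hW i)
    _ ≤ (∑ i, (c i * ‖Ψ i‖ ^ 2) ^ 2) * ∑ i, (√2 * ‖Φ i - Ψ i‖) ^ 2 :=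
        Finset.sum_mul_sq_le_sq_mul_sq _ _ _
    -- Since `0 ≤ e_i ≤ 1`, `∑ e_i² ≤ ∑ e_i = N`.
    _ ≤ N * (2 * frobeniusNorm (Φ - Ψ) ^ 2) := by
        gcongr
        · rw [← hesum]
          exact Finset.sum_le_sum fun i _ => by
            exact pow_le_of_le_one (he0 i) (he1 i) two_ne_zero
        · rw [frobeniusNorm, Real.sq_sqrt (Finset.sum_nonneg fun _ _ => sq_nonneg _),
            Finset.mul_sum]
          exact Finset.sum_le_sum fun i _ => (hsq _).le
    _ = _ := by ring

theorem one_sub_le_inv_det_of_isScalable (hX : X.PosDef) (hunit : ∀ i, ‖Φ i‖ = 1)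
    (hΦ : Inscribed Φ X) (hΨ : IsScalable Ψ)
    (hr : 2 * (N * frobeniusNorm (Φ - Ψ) ^ 2) ≤ 1 / 2) :
    1 - 2 * (N * frobeniusNorm (Φ - Ψ) ^ 2) ≤ X.det⁻¹ := by
  obtain ⟨e, he0, hesum, hle⟩ := exists_weights_near hunit hΨ
  set S := ∑ i, e i • vecMulVec (Φ i).ofLp (Φ i).ofLp with hS
  have htr : S.trace = N := by
    rw [hS, trace_sum, ← hesum]
    simp [trace_smul, trace_vecMulVec_self, hunit, -trace_vecMulVec]
  have h1 := one_sub_le_det (isSymm_sum_smul_vecMulVec e Φ) htr (hle.trans hr)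
  have h2 : (X * S).trace ≤ N := by
    rw [hS, Finset.mul_sum, trace_sum, ← hesum]
    refine Finset.sum_le_sum fun i _ => ?_
    rw [mul_smul_comm, trace_smul, trace_mul_vecMulVec_self, smul_eq_mul]
    exact mul_le_of_le_one_right (he0 i) (hΦ i)
  have h3 := det_mul_det_le_one hX (posSemidef_sum_smul_vecMulVec he0 Φ) h2
  have h4 : S.det ≤ X.det⁻¹ := by
    rwa [← one_div, le_div_iff₀' hX.det_pos]
  linarith

/-! ### Passing to the distance -/

theorem le_of_isFrame (hΦ : IsFrame Φ) : N ≤ M := by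
  obtain ⟨A, B, hA, -, h⟩ := hΦ
  let L : EuclideanSpace ℝ (Fin N) →ₗ[ℝ] Fin M → ℝ :=
    LinearMap.pi fun i => (innerSL ℝ (Φ i)).toLinearMap
  have hL : Function.Injective L := by
    rw [injective_iff_map_eq_zero]
    intro x hx
    have h0 : ∀ i, inner ℝ x (Φ i) = 0 := fun i => by
      rw [real_inner_comm]; exact congrFun hx i
    have h1 := (h x).1
    simp only [h0, abs_zero, ne_eq, OfNat.ofNat_ne_zero, not_false_eq_true, zero_pow,
      Finset.sum_const_zero] at h1
    have h2 : ‖x‖ ^ 2 ≤ 0 := by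
      by_contra! hlt
      exact absurd h1 (not_le.2 (mul_pos hA hlt))
    simpa using le_antisymm h2 (sq_nonneg _)
  simpa using LinearMap.finrank_le_finrank_of_injective hL

/-- The standard basis padded with zeros. Nonemptiness matters because `sInf ∅ = 0` would make the
distance meaningless. -/
theorem exists_isScalable (hNM : N ≤ M) :
    ∃ Ψ : Fin M → EuclideanSpace ℝ (Fin N), IsScalable Ψ := by
  let Ψ : Fin M → EuclideanSpace ℝ (Fin N) := fun i =>
    if h : (i : ℕ) < N then EuclideanSpace.single ⟨i, h⟩ 1 else 0
  have hΨ : ∀ x : EuclideanSpace ℝ (Fin N), ∑ i, |inner ℝ x (Ψ i)| ^ 2 = ‖x‖ ^ 2 := by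
    intro x
    rw [EuclideanSpace.real_norm_sq_eq]
    refine (Finset.sum_of_injOn (Fin.castLE hNM) (Fin.castLE_injective hNM).injOn
      (fun _ _ => Finset.mem_coe.2 (Finset.mem_univ _)) (fun i _ hi => ?_) fun j _ => ?_).symm
    · have : ¬ (i : ℕ) < N := fun h => hi ⟨⟨i, h⟩, Finset.mem_coe.2 (Finset.mem_univ _), rfl⟩
      simp [Ψ, this]
    · simp [Ψ, EuclideanSpace.inner_single_right]
  refine ⟨Ψ, ⟨1, 1, one_pos, one_pos, fun x => ?_⟩, fun _ => 1, fun _ => zero_le_one, 1, one_pos,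
    fun x => ?_⟩
  · rw [hΨ, one_mul]; exact ⟨le_rfl, le_rfl⟩
  · simp only [one_smul]; rw [hΨ, one_mul]

theorem scalableDist_nonneg (Φ : Fin M → EuclideanSpace ℝ (Fin N)) : 0 ≤ scalableDist Φ := by
  refine Real.sInf_nonneg ?_
  rintro r ⟨Ψ, -, rfl⟩
  exact Real.sqrt_nonneg _

theorem exists_isScalable_lt (hΦ : IsFrame Φ) {r : ℝ} (hr : scalableDist Φ < r) :
    ∃ Ψ, IsScalable Ψ ∧ frobeniusNorm (Φ - Ψ) < r := by
  obtain ⟨Ψ, hΨ⟩ := exists_isScalable (le_of_isFrame hΦ)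
  obtain ⟨_, ⟨Ψ', hΨ', rfl⟩, hlt⟩ := exists_lt_of_csInf_lt
    (show {r : ℝ | ∃ Ψ, IsScalable Ψ ∧ r = frobeniusNorm (Φ - Ψ)}.Nonempty from
      ⟨_, Ψ, hΨ, rfl⟩) hr
  exact ⟨Ψ', hΨ', hlt⟩

theorem le_numK (hN : 1 ≤ N) (hΦ : IsFrame Φ) : N ≤ numK M N := by
  refine le_min (le_of_isFrame hΦ) ?_
  rw [Nat.le_div_iff_mul_le two_pos]
  exact Nat.mul_le_mul_left N (by lia)

theorem one_sub_le_inv_det (hN : 1 ≤ N) (hΦ : IsUnitNormFrame Φ)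
    (hd : scalableDist Φ ≤ 1 / 2 * (1 + √(numK M N : ℝ))⁻¹)
    (hX : X.PosDef) (hXΦ : Inscribed Φ X) :
    1 - 2 * (N * scalableDist Φ ^ 2) ≤ X.det⁻¹ := by
  have hd0 := scalableDist_nonneg Φ
  have hNK : √(N : ℝ) ≤ √(numK M N : ℝ) :=
    Real.sqrt_le_sqrt (by exact_mod_cast le_numK hN hΦ.1)
  have hsmall : 2 * (N * scalableDist Φ ^ 2) < 1 / 2 := by
    have h1 := two_mul_sqrt_mul_le hd
    have h2 : √(N : ℝ) * scalableDist Φ < 1 / 2 := by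
      rcases hd0.eq_or_lt with h0 | hpos
      · rw [← h0]; norm_num
      · nlinarith
    have h3 : (√(N : ℝ) * scalableDist Φ) ^ 2 < (1 / 2) ^ 2 := by gcongr
    rw [mul_pow, Real.sq_sqrt (Nat.cast_nonneg N)] at h3
    linarith
  by_contra! hlt
  -- The infimum need not be attained; the strict bound `hsmall` leaves room to take `r` slightly
  -- above it.
  have hcont : Tendsto (fun r : ℝ => 2 * (N * r ^ 2)) (𝓝[>] scalableDist Φ)
      (𝓝 (2 * (N * scalableDist Φ ^ 2))) :=
    (Continuous.tendsto (by fun_prop) _).mono_left nhdsWithin_le_nhds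
  obtain ⟨r, ⟨h1, h2⟩, hr⟩ := (((hcont.eventually_lt_const hsmall).and
    (hcont.eventually_lt_const (show _ < 1 - X.det⁻¹ by linarith))).and
      self_mem_nhdsWithin).exists
  obtain ⟨Ψ, hΨ, hlt⟩ := exists_isScalable_lt hΦ.1 hr
  have hle : 2 * (N * frobeniusNorm (Φ - Ψ) ^ 2) ≤ 2 * (N * r ^ 2) := by
    have : 0 ≤ frobeniusNorm (Φ - Ψ) := Real.sqrt_nonneg _
    gcongr
  have := one_sub_le_inv_det_of_isScalable hX hΦ.2 hXΦ hΨ (by linarith)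
  linarith

/-! ### The approximating frame -/

theorem isScalable_of_tight {Ψ : Fin M → EuclideanSpace ℝ (Fin N)} {ρ : Fin M → ℝ} {A : ℝ}
    (hρ : ∀ i, 0 ≤ ρ i) (hA : 0 < A)
    (h : ∀ x : EuclideanSpace ℝ (Fin N), ∑ i, ρ i * inner ℝ x (Ψ i) ^ 2 = A * ‖x‖ ^ 2) :
    IsScalable Ψ := by
  -- Each weight is at most `1 + ∑ ρ`, which yields the lower frame bound; the added 1 keeps the
  -- divisor positive.
  refine ⟨⟨A / (1 + ∑ i, ρ i), 1 + ∑ i, ‖Ψ i‖ ^ 2, ?_, ?_, fun x => ⟨?_, ?_⟩⟩,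
    fun i => √(ρ i), fun i => Real.sqrt_nonneg _, A, hA, fun x => ?_⟩
  · have := Finset.sum_nonneg fun i (_ : i ∈ Finset.univ) => hρ i
    positivity
  · positivity
  · have h0 := Finset.sum_nonneg fun i (_ : i ∈ Finset.univ) => hρ i
    rw [div_mul_eq_mul_div, div_le_iff₀ (by positivity), ← h x, Finset.sum_mul]
    refine Finset.sum_le_sum fun i _ => ?_
    rw [sq_abs, mul_comm]
    refine mul_le_mul_of_nonneg_left ?_ (sq_nonneg _)
    have := Finset.single_le_sum (f := ρ) (fun j _ => hρ j) (Finset.mem_univ i)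
    linarith
  · rw [add_mul, one_mul, Finset.sum_mul]
    refine le_trans (Finset.sum_le_sum fun i _ => ?_) (le_add_of_nonneg_left (sq_nonneg _))
    rw [← mul_pow, mul_comm]
    gcongr
    exact abs_real_inner_le_norm _ _
  · rw [← h x]
    refine Finset.sum_congr rfl fun i _ => ?_
    rw [sq_abs, inner_smul_right, mul_pow, Real.sq_sqrt (hρ i)]

theorem isScalable_approxFrame (hX : X.PosDef) {ρ : Fin M → ℝ} (hρ : IsWeight Φ X ρ) :
    IsScalable (approxFrame Φ X ρ) := by
  set v := normalizedVolume (ellipsoid X 0) ^ (1 / (N : ℝ)) with hv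
  have hv0 : 0 < v := by
    rw [hv, normalizedVolume_ellipsoid hX]
    exact Real.rpow_pos_of_pos (inv_pos.2 (Real.sqrt_pos.2 hX.det_pos)) _
  refine isScalable_of_tight (A := v ^ 2) hρ.nonneg (by positivity) fun x => ?_
  have hdet : IsUnit (CFC.sqrt X).det := (isUnit_iff_isUnit_det _).1 (isUnit_sqrt hX)
  have hterm : ∀ i, ρ i * inner ℝ x (approxFrame Φ X ρ i) ^ 2 =
      v ^ 2 * (ρ i * ((Φ i).ofLp ⬝ᵥ CFC.sqrt X *ᵥ x.ofLp) ^ 2) := by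
    intro i
    rcases (hρ.nonneg i).eq_or_lt with h0 | hpos
    · rw [← h0]; simp
    · rw [approxFrame, if_pos hpos, inner_smul_right, ← hv, real_inner_comm, inner_toEuclideanLin,
        dotProduct_mulVec, ← mulVec_transpose, transpose_sqrt, dotProduct_comm]
      ring
  have hinv : X⁻¹ = (CFC.sqrt X)⁻¹ * (CFC.sqrt X)⁻¹ := by
    rw [← Matrix.mul_inv_rev, sqrt_mul_sqrt hX]
  have hI : CFC.sqrt X * (X⁻¹ * CFC.sqrt X) = 1 := by
    rw [hinv, mul_assoc, nonsing_inv_mul _ hdet, mul_one, mul_nonsing_inv _ hdet]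
  rw [Finset.sum_congr rfl fun i _ => hterm i, ← Finset.mul_sum,
    ← dotProduct_sum_smul_vecMulVec_mulVec, ← hρ.inv_eq, mulVec_mulVec,
    ← vecMul_transpose (CFC.sqrt X), transpose_sqrt, ← dotProduct_mulVec, mulVec_mulVec, hI,
    one_mulVec, dotProduct_self_eq_norm_sq]

theorem norm_sq_smul_sqrt_sub_le (hX : X.PosDef) (htr : X⁻¹.trace = N) {v : ℝ} (hv : 0 < v)
    (hvN : v ^ N = (√X.det)⁻¹) {φ : EuclideanSpace ℝ (Fin N)}
    (hφ : φ.ofLp ⬝ᵥ X *ᵥ φ.ofLp = 1) :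
    ‖v • toEuclideanLin (CFC.sqrt X) φ - φ‖ ^ 2 ≤ N * (1 - v ^ 2) := by
  have hdet : IsUnit (CFC.sqrt X).det := (isUnit_iff_isUnit_det _).1 (isUnit_sqrt hX)
  set P := (CFC.sqrt X)⁻¹ with hP
  have hPs : P.IsSymm := by
    rw [IsSymm, hP, transpose_nonsing_inv, transpose_sqrt]
  have hPpd : P.PosDef := by
    refine PosDef.inv ?_
    exact (CFC.sqrt_nonneg X).posSemidef.posDef_iff_isUnit.2 (isUnit_sqrt hX)
  have hPP : P * P = X⁻¹ := by rw [hP, ← Matrix.mul_inv_rev, sqrt_mul_sqrt hX]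
  have hPdet : P.det = v ^ N := by
    rw [hP, det_nonsing_inv, Ring.inverse_eq_inv, det_sqrt_eq hX, hvN]
  have htrP := mul_le_trace_of_det_eq_pow hPpd hv hPdet
  set ψ := CFC.sqrt X *ᵥ φ.ofLp with hψ
  have hPψ : P *ᵥ ψ = φ.ofLp := by
    rw [hψ, mulVec_mulVec, hP, nonsing_inv_mul _ hdet, one_mulVec]
  have h1 : (v • toEuclideanLin (CFC.sqrt X) φ - φ).ofLp = (v • 1 - P) *ᵥ ψ := by
    rw [sub_mulVec, smul_mulVec, one_mulVec, hPψ]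
    simp [hψ]
  have h2 : ψ ⬝ᵥ ψ = 1 := by
    rw [← hφ, ← norm_sq_toEuclideanLin_sqrt hX, ← dotProduct_self_eq_norm_sq]
    simp [hψ]
  have hsymm : (v • 1 - P).IsSymm := (isSymm_one.smul v).sub hPs
  have h3 : ((v • 1 - P) * (v • 1 - P)).trace = v ^ 2 * N - 2 * v * P.trace + N := by
    rw [sub_mul, mul_sub, mul_sub, hPP]
    simp only [trace_sub, smul_mul_assoc, mul_smul_comm, one_mul, mul_one, trace_smul, trace_one,
      Fintype.card_fin, smul_eq_mul, htr]
    ring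
  -- The operator norm is bounded by the Frobenius norm, whose square is `N v² - 2 v tr P + N`;
  -- `htrP` turns this into at most `N (1 - v²)`.
  have h4 := mulVec_dotProduct_mulVec_le (v • 1 - P) ψ
  rw [sum_sq_eq_trace_mul_self hsymm, h3, h2, mul_one, ← h1, dotProduct_self_eq_norm_sq] at h4
  nlinarith

theorem mul_one_sub_sq_le (hN : 1 ≤ N) (hΦ : IsUnitNormFrame Φ)
    (hd : scalableDist Φ ≤ 1 / 2 * (1 + √(numK M N : ℝ))⁻¹)
    (hX : X.PosDef) (hXΦ : Inscribed Φ X) (htr : X⁻¹.trace = N) {v : ℝ} (hv : 0 < v)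
    (hvN : v ^ N = (√X.det)⁻¹) :
    N * (1 - v ^ 2) ≤ N * (1 - √(N * (boundNum (numK M N) (scalableDist Φ) /
      boundDen (numK M N) N (scalableDist Φ)))) := by
  have hd0 := scalableDist_nonneg Φ
  set t := N * (boundNum (numK M N) (scalableDist Φ) / boundDen (numK M N) N (scalableDist Φ))
    with ht
  have ht1 : t ≤ 1 := mul_boundNum_div_boundDen_le_one hN hd0 hd
  have hV : v ^ N = √X.det⁻¹ := by rw [hvN, Real.sqrt_inv]
  have hinv : X⁻¹.det = X.det⁻¹ := by rw [det_nonsing_inv, Ring.inverse_eq_inv]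
  suffices √t ≤ v ^ 2 by gcongr
  -- For `N ≥ 2`, `v ≤ 1` gives `v² ≥ v^N = V`. This fails for `N = 1`, where the trace condition
  -- forces `V = 1`.
  rcases hN.eq_or_lt with h1 | h2
  · subst h1
    have : X.det⁻¹ = 1 := by
      rw [← hinv, det_fin_one]
      simpa [trace] using htr
    rw [this, Real.sqrt_one, pow_one] at hV
    rw [hV, one_pow, Real.sqrt_le_one]
    exact ht1
  · have hle : X.det⁻¹ ≤ 1 := by
      rw [← hinv]
      exact det_le_one_of_trace_le hX.inv.posSemidef htr.le
    have hv1 : v ≤ 1 := by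
      have : v ^ N ≤ 1 := by rw [hV]; exact Real.sqrt_le_one.2 hle
      rwa [pow_le_one_iff_of_nonneg hv.le (by lia)] at this
    calc √t ≤ √X.det⁻¹ := Real.sqrt_le_sqrt
          ((mul_boundNum_div_boundDen_le h2 (le_numK hN hΦ.1) hd0 hd).trans
            (one_sub_le_inv_det hN hΦ hd hX hXΦ))
      _ = v ^ N := hV.symm
      _ ≤ v ^ 2 := pow_le_pow_of_le_one hv.le hv1 h2

theorem frobeniusNorm_approxFrame_sub_le (hN : 1 ≤ N) (hΦ : IsUnitNormFrame Φ)
    (hd : scalableDist Φ ≤ 1 / 2 * (1 + √(numK M N : ℝ))⁻¹)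
    (hX : X.PosDef) (hXΦ : Inscribed Φ X) (htr : X⁻¹.trace = N) {ρ : Fin M → ℝ}
    (hρ : IsWeight Φ X ρ) :
    frobeniusNorm (approxFrame Φ X ρ - Φ) ≤ errorBound (numK M N) N (scalableDist Φ) := by
  classical
  have hV0 : 0 < (√X.det)⁻¹ := inv_pos.2 (Real.sqrt_pos.2 hX.det_pos)
  have hv : 0 < (√X.det)⁻¹ ^ (1 / (N : ℝ)) := Real.rpow_pos_of_pos hV0 _
  have hvN : ((√X.det)⁻¹ ^ (1 / (N : ℝ))) ^ N = (√X.det)⁻¹ := by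
    rw [one_div]
    exact Real.rpow_inv_natCast_pow hV0.le (by lia)
  have hb := mul_one_sub_sq_le hN hΦ hd hX hXΦ htr hv hvN
  have ht1 := mul_boundNum_div_boundDen_le_one hN (scalableDist_nonneg Φ) hd
  unfold frobeniusNorm errorBound
  set t := N * (boundNum (numK M N) (scalableDist Φ) / boundDen (numK M N) N (scalableDist Φ))
    with ht
  have hst : 0 ≤ 1 - √t := sub_nonneg.2 (Real.sqrt_le_one.2 ht1)
  rw [← Real.sqrt_mul (by positivity)]
  refine Real.sqrt_le_sqrt ?_
  calc ∑ i, ‖(approxFrame Φ X ρ - Φ) i‖ ^ 2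
      ≤ ∑ i, if 0 < ρ i then N * (1 - √t) else 0 := by
        refine Finset.sum_le_sum fun i _ => ?_
        rw [Pi.sub_apply, approxFrame]
        split_ifs with hi
        · rw [normalizedVolume_ellipsoid hX]
          exact (norm_sq_smul_sqrt_sub_le hX htr hv hvN
            (quad_eq_one_of_isWeight hX hΦ.2 hXΦ htr hρ hi)).trans hb
        · simp
    _ = (Finset.univ.filter fun i => 0 < ρ i).card * (N * (1 - √t)) := by
        rw [← Finset.sum_filter, Finset.sum_const, nsmul_eq_mul]
    _ ≤ numK M N * (N * (1 - √t)) := by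
        have hc : (Finset.univ.filter fun i => 0 < ρ i).card ≤ numK M N := by
          convert hρ.card_le
        refine mul_le_mul_of_nonneg_right ?_ (by positivity)
        exact_mod_cast hc
    _ = numK M N * N * (1 - √t) := by ring

end ScalableFrames

theorem theorem3p4 :
    ∃ C : ℝ, 0 < C ∧
      ∀ (M N : ℕ) (Φ : Fin M → EuclideanSpace ℝ (Fin N)), 1 ≤ N →
        ScalableFrames.IsUnitNormFrame Φ →
        ScalableFrames.scalableDist Φ ≤
          1 / 2 * (1 + Real.sqrt (ScalableFrames.numK M N : ℝ))⁻¹ →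
        -- the bound is meaningful, and it is `K √N O(d_Φ)` with an absolute constant
        (0 < ScalableFrames.boundNum (ScalableFrames.numK M N) (ScalableFrames.scalableDist Φ) ∧
          0 < ScalableFrames.boundDen (ScalableFrames.numK M N) N
            (ScalableFrames.scalableDist Φ) ∧
          Real.sqrt (N *
            (ScalableFrames.boundNum (ScalableFrames.numK M N) (ScalableFrames.scalableDist Φ) /
              ScalableFrames.boundDen (ScalableFrames.numK M N) N
                (ScalableFrames.scalableDist Φ))) ≤ 1 ∧
          ScalableFrames.errorBound (ScalableFrames.numK M N) N (ScalableFrames.scalableDist Φ) ≤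
            C * (ScalableFrames.numK M N * Real.sqrt N * ScalableFrames.scalableDist Φ)) ∧
        -- the minimal ellipsoid `E(X)` of `Φ` exists
        (∃ X : Matrix (Fin N) (Fin N) ℝ, X.PosDef ∧
          ScalableFrames.IsMinimalEllipsoidOf Φ (ScalableFrames.ellipsoid X 0)) ∧
        ∀ X : Matrix (Fin N) (Fin N) ℝ, X.PosDef →
          ScalableFrames.IsMinimalEllipsoidOf Φ (ScalableFrames.ellipsoid X 0) →
          -- weights `ρ` exist, and every choice of them gives a good scalable approximation
          (∃ ρ : Fin M → ℝ, ScalableFrames.IsWeight Φ X ρ) ∧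
          ∀ ρ : Fin M → ℝ, ScalableFrames.IsWeight Φ X ρ →
            ScalableFrames.IsScalable (ScalableFrames.approxFrame Φ X ρ) ∧
            ScalableFrames.frobeniusNorm (ScalableFrames.approxFrame Φ X ρ - Φ) ≤
              ScalableFrames.errorBound (ScalableFrames.numK M N) N
                (ScalableFrames.scalableDist Φ) := by
  refine ⟨4, by norm_num, fun M N Φ hN hΦ hd => ?_⟩
  have hd0 := ScalableFrames.scalableDist_nonneg Φ
  have hNK := ScalableFrames.le_numK hN hΦ.1
  refine ⟨⟨ScalableFrames.boundNum_pos hd0 hd, ScalableFrames.boundDen_pos hN hd0 hd,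
    Real.sqrt_le_one.2 (ScalableFrames.mul_boundNum_div_boundDen_le_one hN hd0 hd),
    ScalableFrames.errorBound_le hN (hN.trans hNK) hd0 hd⟩, ?_, fun X hX hmin => ?_⟩
  · obtain ⟨X, hX, hXΦ, hmax⟩ := ScalableFrames.exists_det_maximizer hΦ
    exact ⟨X, hX, (ScalableFrames.isMinimalEllipsoidOf_ellipsoid_iff hX).2 ⟨hXΦ, hmax⟩⟩
  · obtain ⟨hXΦ, hmax⟩ := (ScalableFrames.isMinimalEllipsoidOf_ellipsoid_iff hX).1 hmin
    have htr := ScalableFrames.trace_inv_eq hN hX hΦ.2 hXΦ hmax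
    exact ⟨ScalableFrames.exists_isWeight hN hX hΦ.2 hXΦ hmax, fun ρ hρ =>
      ⟨ScalableFrames.isScalable_approxFrame hX hρ,
        ScalableFrames.frobeniusNorm_approxFrame_sub_le hN hΦ hd hX hXΦ htr hρ⟩⟩
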